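/- Let $n\in\mathbb N$, $\mathcal O=\mathbb C[[t]]$, $\mathcal K=\mathbb C((t))$, $G=SL_n$ and $G'=PSL_n$ (the adjoint algebraic group over $\mathbb C$, so $G'(R)=GL_n(R)/R^\times$ for every local ring $R$). Let $\mathcal G'=G'(\mathcal K)/G'(\mathcal O)$ be the affine Grassmannian of $G'$, with its ind-Zariski topology and the action of $G(\mathcal K)$ by left translation. A coweight is the class of some $\mu\in\mathbb Z^n$ modulo $\mathbb Z(1,\dots,1)$; it defines the point of $\mathcal G'$, again denoted $\mu$, represented by $\mathrm{diag}(t^{-\mu_1},\dots,t^{-\mu_n})$, whose stabilizer in $G(\mathcal K)$ is the parahoric subgroup $$\mathcal P_\mu=\{A\in SL_n(\mathcal K)\mid \text{if } t^k \text{ occurs in the entry } A_{ij},\text{ then } (\epsilon_i-\epsilon_j,\mu)+k\ge 0\}.$$ Put $\mathcal Q_{\mu,\nu}=\mathcal P_\mu\cap\mathcal P_\nu$. For a word $w=(i_1,\dots,i_N)$ in the alphabet $\{1,\dots,n\}$ let $\mu_j^w=\epsilon_{i_1}+\dots+\epsilon_{i_j}$, $0\le j\le N$. Fix a word $c$ of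 length $N$ (the center; the construction is independent of it up to canonical isomorphism) and write $\mu_j=\mu_j^c$. The Bott--Samelson variety of type $(1,\dots,1)$ ($N$ entries) is $$\Sigma=\mathcal P_{\mu_0}\times_{\mathcal Q_{\mu_0,\mu_1}}\mathcal P_{\mu_1}\times\cdots\times_{\mathcal Q_{\mu_{N-1},\mu_N}}\mathcal P_{\mu_N}/\mathcal P_{\mu_N},$$ the quotient of $\prod_j\mathcal P_{\mu_j}$ by $(p_0,\dots,p_N)\sim(p_0q_0,\,q_0^{-1}p_1q_1,\,\dots,\,q_{N-1}^{-1}p_Nq_N)$ with $q_j\in\mathcal Q_{\mu_j,\mu_{j+1}}$ for $j<N$ and $q_N\in\mathcal P_{\mu_N}$. Let $\pi:\Sigma\to\mathcal G'$ be the map $\pi([p_0,\dots,p_N])=p_0\cdots p_{N-1}\,\mu_N$. The torus fixed point $y_w\in\Sigma$ of a word $w$ of length $N$ is the point $[p_0,\dots,p_N]$ with $p_0\cdots p_{j-1}\,\mu_j=\mu^w_j$ in $\mathcal G'$ for $0\le j\le N$. Let $\eta(s)=\mathrm{diag}(s^{a_1},\dots,s^{a_n})$ with integers $a_1<\dots<a_n$,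 $\sum_i a_i=0$, be a generic anti-dominant one-parameter subgroup, acting on $\Sigma$ by left multiplication on $p_0$. The cell of $w$ is $$C_w=\{x\in\Sigma\mid \lim_{s\to0}\eta(s)x=y_w\},$$ where the limit is taken in the classical (complex) topology of $\Sigma$. **Lemma.** Let $w_1,w_2$ be words of length $N$ that are related by a single Knuth relation, that is, for some words $v_1,v_2$ and letters $x,y,z$ either - $\{w_1,w_2\}=\{v_1\,yxz\,v_2,\ v_1\,yzx\,v_2\}$ with $x\le y<z$, or - $\{w_1,w_2\}=\{v_1\,xzy\,v_2,\ v_1\,zxy\,v_2\}$ with $x<y\le z$. Then $\overline{\pi(C_{w_1})}=\overline{\pi(C_{w_2})}$, the closures being the Zariski closures in $\mathcal G'$ (equivalently, in the closed Schubert variety $X_{N\epsilon_1}=\overline{G(\mathcal O)\cdot N\epsilon_1}$, in which $\pi$ takes its values). -/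

import Mathlib

open scoped MatrixGroups LaurentSeries PowerSeries Topology

namespace KnuthMV

/-! ### Words and Knuth relations -/

/-- Two words are related by a single Knuth relation (the alphabet `{1, …, n}` is `Fin n`):
`u = v₁ x z y v₂`, `w = v₁ z x y v₂` with `x < y ≤ z`, or
`u = v₁ y z x v₂`, `w = v₁ y x z v₂` with `x ≤ y < z`. -/
inductive KnuthRelation {n : ℕ} : List (Fin n) → List (Fin n) → Prop
  | xzy_zxy (v₁ v₂ : List (Fin n)) (x y z : Fin n) (hxy : x < y) (hyz : y ≤ z) :
      KnuthRelation (v₁ ++ [x, z, y] ++ v₂) (v₁ ++ [z, x, y] ++ v₂)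
  | yzx_yxz (v₁ v₂ : List (Fin n)) (x y z : Fin n) (hxy : x ≤ y) (hyz : y < z) :
      KnuthRelation (v₁ ++ [y, z, x] ++ v₂) (v₁ ++ [y, x, z] ++ v₂)

/-- The `j`-th vertex `μ_j = ε_{i₁} + ⋯ + ε_{i_j}` of the polyline of the word `(i₁, …, i_N)`.
Coweights of `PSL_n` are classes of integer vectors modulo `(1, …, 1)`; we work with
representatives, and everything below depends on the differences `μ i - μ j` only. -/
def vertex {n : ℕ} (w : List (Fin n)) (j : ℕ) : Fin n → ℤ :=
  fun i => ((w.take j).count i : ℤ)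

/-! ### The affine Grassmannian of `PSL_n` -/

/-- The subgroup `G'(𝒪)` of `G'(𝒦)`, where `G' = PSL_n` as an algebraic group over `ℂ`,
`𝒪 = ℂ⟦t⟧`, `𝒦 = ℂ((t))`. For a local ring `R` the group of `R`-points of the algebraic group
`PSL_n = PGL_n` is `GL_n(R) / Rˣ`. -/
noncomputable def integralPoints (n : ℕ) : Subgroup PGL(n, ℂ⸨X⸩) :=
  ((Matrix.ProjGenLinGroup.mk (n := Fin n) (R := ℂ⸨X⸩)).comp
    (Matrix.GeneralLinearGroup.map (n := Fin n) (algebraMap ℂ⟦X⟧ ℂ⸨X⸩))).range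

/-- The affine Grassmannian `𝒢' = G'(𝒦) / G'(𝒪)` of `G' = PSL_n`. -/
def AffineGrassmannian (n : ℕ) : Type := PGL(n, ℂ⸨X⸩) ⧸ integralPoints n

/-- `G'(𝒦)` acts on `𝒢'` by left translation. -/
noncomputable instance (n : ℕ) : MulAction PGL(n, ℂ⸨X⸩) (AffineGrassmannian n) :=
  inferInstanceAs (MulAction PGL(n, ℂ⸨X⸩) (PGL(n, ℂ⸨X⸩) ⧸ integralPoints n))

/-- The canonical map `GL_n(𝒦) → 𝒢'`. -/
noncomputable def AffineGrassmannian.ofGL {n : ℕ} (g : GL (Fin n) ℂ⸨X⸩) : AffineGrassmannian n :=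
  QuotientGroup.mk (Matrix.ProjGenLinGroup.mk g)

/-- The part of `GL_n(𝒦)` of the matrices `g` such that all entries of `g` and of `g⁻¹` have a pole
of order at most `a`. -/
def boundedGL (n a : ℕ) : Set (GL (Fin n) ℂ⸨X⸩) :=
  {g | ∀ i j, ∀ k : ℤ, k < -(a : ℤ) →
    (g.1 i j).coeff k = 0 ∧ ((g⁻¹ : GL (Fin n) ℂ⸨X⸩).1 i j).coeff k = 0}

/-- The coordinates of `g`: the Laurent coefficients of the entries of `g` and of `g⁻¹`. -/
noncomputable def coordinates {n : ℕ} (g : GL (Fin n) ℂ⸨X⸩) : (Fin n × Fin n × ℤ) ⊕ (Fin n × Fin n × ℤ) → ℂ :=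
  Sum.elim (fun v => (g.1 v.1 v.2.1).coeff v.2.2)
    (fun v => ((g⁻¹ : GL (Fin n) ℂ⸨X⸩).1 v.1 v.2.1).coeff v.2.2)

/-- The Zariski topology on `σ → ℂ`: the closed sets are the common zero sets of families of
polynomials in the variables `σ`. -/
@[reducible] noncomputable def zariski (σ : Type) : TopologicalSpace (σ → ℂ) :=
  TopologicalSpace.induced
    (MvPolynomial.pointToPoint : (σ → ℂ) → PrimeSpectrum (MvPolynomial σ ℂ)) inferInstance

/-- The ind-Zariski topology on `GL_n(𝒦)`: a set is closed iff for every `a` its intersection with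
`boundedGL n a` is cut out there by polynomials in the coordinates. -/
@[reducible] noncomputable def zariskiGL (n : ℕ) : TopologicalSpace (GL (Fin n) ℂ⸨X⸩) :=
  ⨆ a : ℕ, TopologicalSpace.coinduced (Subtype.val : boundedGL n a → GL (Fin n) ℂ⸨X⸩)
    (TopologicalSpace.induced (fun g : boundedGL n a => coordinates g.1) (zariski _))

/-- The ind-Zariski topology on `𝒢'`, as the quotient of `GL_n(𝒦)`. -/
noncomputable instance (n : ℕ) : TopologicalSpace (AffineGrassmannian n) :=
  TopologicalSpace.coinduced AffineGrassmannian.ofGL (zariskiGL n)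

/-- The diagonal matrix `diag(t^{ν 1}, …, t^{ν n})`. -/
noncomputable def tPow {n : ℕ} (ν : Fin n → ℤ) : GL (Fin n) ℂ⸨X⸩ where
  val := Matrix.diagonal fun i => HahnSeries.single (ν i) 1
  inv := Matrix.diagonal fun i => HahnSeries.single (-ν i) 1
  val_inv := by simp [Matrix.diagonal_mul_diagonal]
  inv_val := by simp [Matrix.diagonal_mul_diagonal]

/-- The point of `𝒢'` attached to a coweight `μ`. The sign is the one for which its stabilizer
is the parahoric subgroup containing the affine root subgroups `U_{(α, k)} = {1 + c t^k E_α}` with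
`(α, μ) + k ≥ 0`. -/
noncomputable def coweightPoint {n : ℕ} (μ : Fin n → ℤ) : AffineGrassmannian n :=
  AffineGrassmannian.ofGL (tPow (-μ))

/-! ### Parahoric subgroups of `G(𝒦) = SL_n(𝒦)` -/

/-- Helper: `A` satisfies the condition defining `parahoric μ` iff `A ∈ t^{-μ} SL_n(𝒪) t^{μ}`. -/
theorem parahoric_aux {n : ℕ} (μ : Fin n → ℤ) (A : SL(n, ℂ⸨X⸩)) :
    (∀ i j, ∀ k : ℤ, (A.1 i j).coeff k ≠ 0 → 0 ≤ μ i - μ j + k) ↔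
      ∃ B : SL(n, ℂ⟦X⟧), Matrix.SpecialLinearGroup.toGL A =
        tPow (-μ) * Matrix.SpecialLinearGroup.mapGL ℂ⸨X⸩ B * (tPow (-μ))⁻¹ := by
  have key : ∀ B : SL(n, ℂ⟦X⟧), (Matrix.SpecialLinearGroup.toGL A =
        tPow (-μ) * Matrix.SpecialLinearGroup.mapGL ℂ⸨X⸩ B * (tPow (-μ))⁻¹) ↔
        ∀ i j, ∀ k : ℤ, (A.1 i j).coeff k =
          (HahnSeries.ofPowerSeries ℤ ℂ (B.1 i j)).coeff (k + μ i - μ j) := by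
    intro B
    rw [Units.ext_iff, ← Matrix.ext_iff]
    have e : ∀ i j, ((tPow (-μ) * Matrix.SpecialLinearGroup.mapGL ℂ⸨X⸩ B * (tPow (-μ))⁻¹ :
        GL (Fin n) ℂ⸨X⸩).1) i j = HahnSeries.single (-μ i) 1 *
          HahnSeries.ofPowerSeries ℤ ℂ (B.1 i j) * HahnSeries.single (μ j) 1 := by
      intro i j
      change ((Matrix.diagonal (fun i => HahnSeries.single ((-μ) i) (1 : ℂ)) *
        (B.1.map (algebraMap ℂ⟦X⟧ ℂ⸨X⸩))) *
        Matrix.diagonal (fun i => HahnSeries.single (-(-μ) i) (1 : ℂ))) i j = _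
      rw [Matrix.mul_diagonal, Matrix.diagonal_mul]
      simp
    refine forall_congr' fun i => forall_congr' fun j => ?_
    rw [e, HahnSeries.ext_iff, funext_iff]
    refine forall_congr' fun k => ?_
    rw [HahnSeries.coeff_mul_single, HahnSeries.coeff_single_mul]
    have : k - μ j - -μ i = k + μ i - μ j := by ring
    rw [this]
    simp
  simp only [key]
  constructor
  · intro h
    let M : Matrix (Fin n) (Fin n) ℂ⟦X⟧ :=
      fun i j => PowerSeries.mk fun m => (A.1 i j).coeff (m - μ i + μ j)
    have hM : ∀ i j, ∀ k : ℤ, (A.1 i j).coeff k =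
          (HahnSeries.ofPowerSeries ℤ ℂ (M i j)).coeff (k + μ i - μ j) := by
      intro i j k
      rw [PowerSeries.coeff_coe]
      split_ifs with hk
      · by_contra hne
        have := h i j k hne
        omega
      · simp only [M, PowerSeries.coeff_mk]
        congr 1
        omega
    have hA : A.1 = Matrix.diagonal (fun i => HahnSeries.single (-μ i) (1 : ℂ)) *
        (M.map (algebraMap ℂ⟦X⟧ ℂ⸨X⸩)) *
        Matrix.diagonal (fun i => HahnSeries.single (μ i) (1 : ℂ)) := by
      ext i j k
      rw [Matrix.mul_diagonal, Matrix.diagonal_mul, HahnSeries.coeff_mul_single,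
        HahnSeries.coeff_single_mul, hM]
      have : k - μ j - -μ i = k + μ i - μ j := by ring
      rw [this]
      simp
    have hdet : M.det = 1 := by
      have h1 := A.2
      rw [hA, Matrix.det_mul, Matrix.det_mul, mul_right_comm, ← Matrix.det_mul,
        Matrix.diagonal_mul_diagonal] at h1
      have h2 : (M.map (algebraMap ℂ⟦X⟧ ℂ⸨X⸩)).det = 1 := by
        simpa using h1
      have h3 : algebraMap ℂ⟦X⟧ ℂ⸨X⸩ M.det = algebraMap ℂ⟦X⟧ ℂ⸨X⸩ 1 := by
        rw [RingHom.map_det, map_one]; exact h2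
      exact IsFractionRing.injective ℂ⟦X⟧ ℂ⸨X⸩ h3
    exact ⟨⟨M, hdet⟩, hM⟩
  · rintro ⟨B, hB⟩ i j k hk
    rw [hB, PowerSeries.coeff_coe] at hk
    by_contra hlt
    rw [if_pos (by omega)] at hk
    exact hk rfl

/-- The parahoric subgroup `𝒫_μ` of `SL_n(𝒦)`: every affine root `(ε_i - ε_j, k)` that occurs in a
matrix of `𝒫_μ` (as the coefficient of `t^k` in the entry `(i, j)`) satisfies
`μ ∈ H⁺_{ε_i - ε_j, k}`, that is `(ε_i - ε_j, μ) + k ≥ 0`. -/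
noncomputable def parahoric {n : ℕ} (μ : Fin n → ℤ) : Subgroup SL(n, ℂ⸨X⸩) where
  carrier := {A | ∀ i j, ∀ k : ℤ, (A.1 i j).coeff k ≠ 0 → 0 ≤ μ i - μ j + k}
  one_mem' := (parahoric_aux μ 1).2 ⟨1, by simp⟩
  mul_mem' {A A'} hA hA' := by
    obtain ⟨B, hB⟩ := (parahoric_aux μ A).1 hA
    obtain ⟨B', hB'⟩ := (parahoric_aux μ A').1 hA'
    exact (parahoric_aux μ _).2 ⟨B * B', by rw [map_mul, map_mul, hB, hB']; group⟩
  inv_mem' {A} hA := by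
    obtain ⟨B, hB⟩ := (parahoric_aux μ A).1 hA
    exact (parahoric_aux μ _).2 ⟨B⁻¹, by rw [map_inv, map_inv, hB]; group⟩

/-- The parahoric subgroup `𝒬` attached to the segment `[μ, ν]`: a half space `H⁺` contains
`[μ, ν]` iff it contains `μ` and `ν`. -/
noncomputable def segmentParahoric {n : ℕ} (μ ν : Fin n → ℤ) : Subgroup SL(n, ℂ⸨X⸩) :=
  parahoric μ ⊓ parahoric ν

/-- Helper: `𝒫_μ` fixes the point `μ` of `𝒢'`. -/
theorem parahoric_smul {n : ℕ} (μ : Fin n → ℤ) {A : SL(n, ℂ⸨X⸩)} (hA : A ∈ parahoric μ) :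
    Matrix.SpecialLinearGroup.toPGL A • coweightPoint μ = coweightPoint μ := by
  obtain ⟨B, hB⟩ := (parahoric_aux μ A).1 hA
  change (QuotientGroup.mk (Matrix.ProjGenLinGroup.mk (Matrix.SpecialLinearGroup.toGL A) *
    Matrix.ProjGenLinGroup.mk (tPow (-μ))) : PGL(n, ℂ⸨X⸩) ⧸ integralPoints n) =
      QuotientGroup.mk (Matrix.ProjGenLinGroup.mk (tPow (-μ)))
  rw [eq_comm, QuotientGroup.eq, hB]
  refine ⟨Matrix.SpecialLinearGroup.toGL B, ?_⟩
  rw [← map_mul, ← map_inv, ← map_mul]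
  have e : Matrix.GeneralLinearGroup.map (n := Fin n) (algebraMap ℂ⟦X⟧ ℂ⸨X⸩)
      (Matrix.SpecialLinearGroup.toGL B) = Matrix.SpecialLinearGroup.mapGL ℂ⸨X⸩ B :=
    Units.ext rfl
  rw [MonoidHom.comp_apply, e]
  congr 1
  group

/-! ### The Bott-Samelson variety of type `(1, …, 1)` with center a word `c` -/

/-- The product `𝒫_{μ_0} × 𝒫_{μ_1} × ⋯ × 𝒫_{μ_N}`, where `(μ_0, …, μ_N)` is the polyline of `c`. -/
structure ParahoricProduct {n : ℕ} (c : List (Fin n)) : Type where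
  /-- The tuple `(p_0, …, p_N)`. -/
  toFun : Fin (c.length + 1) → SL(n, ℂ⸨X⸩)
  mem : ∀ j : Fin (c.length + 1), toFun j ∈ parahoric (vertex c j)

/-- The classical topology on the product of the parahoric subgroups: the coarsest topology for
which all Laurent coefficients of all matrix entries are continuous functions with values
in `ℂ` (with its usual topology). -/
noncomputable instance {n : ℕ} (c : List (Fin n)) : TopologicalSpace (ParahoricProduct c) :=
  TopologicalSpace.induced
    (fun (p : ParahoricProduct c) (v : Fin (c.length + 1) × Fin n × Fin n × ℤ) =>
      ((p.1 v.1).1 v.2.1 v.2.2.1).coeff v.2.2.2) Pi.topologicalSpace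

/-- Two tuples define the same point of the Bott-Samelson variety iff they are in the same orbit of
`𝒬_0 × ⋯ × 𝒬_{N-1} × 𝒫_{μ_N}` acting by
`(q_0, …, q_N) ∘ (p_0, …, p_N) = (p_0 q_0, q_0⁻¹ p_1 q_1, …, q_{N-1}⁻¹ p_N q_N)`. -/
def bottSamelsonSetoid {n : ℕ} (c : List (Fin n)) : Setoid (ParahoricProduct c) where
  r p p' := ∃ q : Fin (c.length + 1) → SL(n, ℂ⸨X⸩),
    (∀ j : Fin c.length, q j.castSucc ∈ segmentParahoric (vertex c j) (vertex c (j + 1))) ∧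
    q (Fin.last _) ∈ parahoric (vertex c c.length) ∧
    p'.1 0 = p.1 0 * q 0 ∧
    ∀ j : Fin c.length, p'.1 j.succ = (q j.castSucc)⁻¹ * p.1 j.succ * q j.succ
  iseqv :=
    { refl := fun p => ⟨fun _ => 1, fun _ => one_mem _, one_mem _, by simp, by simp⟩
      symm := by
        rintro p p' ⟨q, hq, hl, h0, hs⟩
        refine ⟨fun j => (q j)⁻¹, fun j => inv_mem (hq j), inv_mem hl, ?_, fun j => ?_⟩
        · rw [h0]; group
        · rw [hs]; group
      trans := by
        rintro p p' p'' ⟨q, hq, hl, h0, hs⟩ ⟨q', hq', hl', h0', hs'⟩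
        refine ⟨fun j => q j * q' j, fun j => mul_mem (hq j) (hq' j), mul_mem hl hl', ?_,
          fun j => ?_⟩
        · rw [h0', h0]; group
        · rw [hs', hs]; group }

/-- The Bott-Samelson variety
`Σ = 𝒫_{μ_0} ×_{𝒬_0} 𝒫_{μ_1} ×_{𝒬_1} ⋯ ×_{𝒬_{N-1}} 𝒫_{μ_N} / 𝒫_{μ_N}` of type `(1, …, 1)`, with
center the word `c` of length `N`. -/
def BottSamelson {n : ℕ} (c : List (Fin n)) : Type := Quotient (bottSamelsonSetoid c)

/-- The classical topology of `Σ`: the quotient topology. -/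
noncomputable instance {n : ℕ} (c : List (Fin n)) : TopologicalSpace (BottSamelson c) :=
  inferInstanceAs (TopologicalSpace (Quotient (bottSamelsonSetoid c)))

namespace BottSamelson

/-- The map `Σ → 𝒢'`, `[p_0, …, p_N] ↦ p_0 ⋯ p_{j-1} μ_j`, for `0 ≤ j ≤ N`. -/
noncomputable def point {n : ℕ} {c : List (Fin n)} (j : Fin (c.length + 1)) :
    BottSamelson c → AffineGrassmannian n :=
  Quotient.lift
    (fun p : ParahoricProduct c =>
      Matrix.SpecialLinearGroup.toPGL (Fin.partialProd (fun i : Fin c.length => p.1 i.castSucc) j) •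
        coweightPoint (vertex c j))
    (by
      rintro p p' ⟨q, hq, hl, h0, hs⟩
      cases j using Fin.cases with
      | zero => simp
      | succ j =>
        have key : Fin.partialProd (fun i : Fin c.length => p'.1 i.castSucc) j.succ =
            Fin.partialProd (fun i : Fin c.length => p.1 i.castSucc) j.succ * q j.castSucc := by
          obtain ⟨j, hj⟩ := j
          induction j with
          | zero =>
            rw [Fin.partialProd_succ, Fin.partialProd_succ]
            have e : Fin.castSucc (⟨0, hj⟩ : Fin c.length) = 0 := rfl
            simp only [e, Fin.partialProd_zero, one_mul]
            exact h0
          | succ j ih =>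
            have ih := ih (by omega)
            rw [Fin.partialProd_succ, Fin.partialProd_succ]
            have e : Fin.castSucc (⟨j + 1, hj⟩ : Fin c.length) =
              Fin.succ (⟨j, by omega⟩ : Fin c.length) := rfl
            rw [e, ih, hs]
            group
        have hmem : q j.castSucc ∈ parahoric (vertex c ((j.succ : Fin (c.length + 1)) : ℕ)) :=
          (hq j).2
        rw [key, map_mul, mul_smul, parahoric_smul _ hmem])

/-- The map `π : Σ → 𝒢'`, `[p_0, …, p_N] ↦ p_0 ⋯ p_{N-1} μ_N`. -/
noncomputable def π {n : ℕ} (c : List (Fin n)) : BottSamelson c → AffineGrassmannian n :=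
  point (Fin.last c.length)

/-- The action of `g ∈ 𝒫_{μ_0} = SL_n(𝒪)` on `Σ`: `g [p_0, p_1, …, p_N] = [g p_0, p_1, …, p_N]`. -/
noncomputable def translate {n : ℕ} {c : List (Fin n)} (g : parahoric (vertex c 0)) :
    BottSamelson c → BottSamelson c :=
  Quotient.map
    (fun p : ParahoricProduct c => ⟨Function.update p.1 0 (g.1 * p.1 0), fun j => by
      by_cases hj : j = 0
      · subst hj
        simpa using mul_mem g.2 (p.2 0)
      · simpa [Function.update_of_ne hj] using p.2 j⟩)
    (by
      rintro p p' ⟨q, hq, hl, h0, hs⟩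
      refine ⟨q, hq, hl, ?_, fun j => ?_⟩
      · simp [h0, mul_assoc]
      · simpa using hs j)

end BottSamelson

/-! ### One-parameter subgroups and cells -/

/-- Helper: the matrix `diag(s^{a 1}, …, s^{a n})` has determinant `1` if `∑ a i = 0`. -/
theorem det_oneParameter {n : ℕ} (a : Fin n → ℤ) (ha : ∑ i, a i = 0) (s : ℂˣ) :
    (Matrix.diagonal fun i => HahnSeries.C ((s ^ a i : ℂˣ) : ℂ) :
      Matrix (Fin n) (Fin n) ℂ⸨X⸩).det = 1 := by
  have h : ∀ u : Finset (Fin n), ∏ i ∈ u, s ^ a i = s ^ (∑ i ∈ u, a i) := fun u => by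
    induction u using Finset.induction_on with
    | empty => rw [Finset.prod_empty, Finset.sum_empty, zpow_zero]
    | insert i u hi ih => rw [Finset.prod_insert hi, Finset.sum_insert hi, ih, zpow_add]
  rw [Matrix.det_diagonal, ← map_prod, ← Units.coe_prod, h, ha, zpow_zero, Units.val_one, map_one]

/-- The value at `s ∈ ℂˣ` of the one-parameter subgroup
`η : s ↦ diag(s^{a 1}, …, s^{a n})` of the torus `T ⊂ SL_n(ℂ)`, as an element of
`𝒫_{μ_0} = SL_n(𝒪) ⊂ SL_n(𝒦)`. -/
noncomputable def oneParameter {n : ℕ} (a : Fin n → ℤ) (ha : ∑ i, a i = 0) (c : List (Fin n))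
    (s : ℂˣ) : parahoric (vertex c 0) :=
  ⟨⟨Matrix.diagonal fun i => HahnSeries.C ((s ^ a i : ℂˣ) : ℂ), det_oneParameter a ha s⟩, by
    intro i j k hk
    change (Matrix.diagonal (fun i => HahnSeries.C ((s ^ a i : ℂˣ) : ℂ)) i j).coeff k ≠ 0 at hk
    by_cases hij : i = j
    · subst hij
      by_cases h0 : k = 0
      · rw [h0, sub_self, add_zero]
      · refine absurd ?_ hk
        rw [Matrix.diagonal_apply_eq, HahnSeries.C_apply, HahnSeries.coeff_single_of_ne h0]
    · refine absurd ?_ hk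
      rw [Matrix.diagonal_apply_ne _ hij, HahnSeries.coeff_zero]⟩

/-- `y ∈ Σ` is the torus fixed point that corresponds to the word `w` (of the same length as the
center `c`): it is mapped to the vertices of the polyline of `w`. In terms of parahoric subgroups,
`p_0 ⋯ p_{j-1} 𝒫_{μ_j(c)} (p_0 ⋯ p_{j-1})⁻¹ = 𝒫_{μ_j(w)}` for all `j`. -/
def IsFixedPointOf {n : ℕ} {c : List (Fin n)} (w : List (Fin n)) (y : BottSamelson c) : Prop :=
  ∀ j : Fin (c.length + 1), y.point j = coweightPoint (vertex w j)

/-- The Białynicki-Birula cell `C_w = {x ∈ Σ | lim_{s → 0} η(s) x = y_w}`, where `y_w` is the fixed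
point of `w` and `η(s) = diag(s^{a 1}, …, s^{a n})`. -/
def cell {n : ℕ} (a : Fin n → ℤ) (ha : ∑ i, a i = 0) (c w : List (Fin n)) :
    Set (BottSamelson c) :=
  {x | ∃ y : BottSamelson c, IsFixedPointOf w y ∧
    Filter.Tendsto (fun s : ℂˣ => BottSamelson.translate (oneParameter a ha c s) x)
      (Filter.comap Units.val (𝓝 (0 : ℂ))) (𝓝 y)}

end KnuthMV

/-! Write E_i(b) = (1 + ∑_{l ≠ i} b_l E_{li}) t^{-ε_i} for an elementary step of type i, L_i for the
set of those with b_l = 0 for all l ≤ i, and U for the lower unipotent matrices over 𝒪. Both sides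
of the claim are computed with products of such steps in GL_n(𝒦).

A point of Σ is determined by its gallery of points in 𝒢' (`BottSamelson.ext_point`), and near y_w
these galleries are given, with unique normalized parameters, by the partial products of elementary
steps whose types are the letters of w. The one-parameter subgroup η(s) multiplies the parameter b_l
of a step of type i by s^{a_l - a_i}. As a is increasing, the limit for s → 0 is y_w exactly if b_l
= 0 for all l ≤ i in each step. Hence π(C_w) is the image in 𝒢' of the product of the sets L_i over
the letters of w, for any center (`image_cell_eq`).

The rest is algebra with three letters. Since U L_i ⊆ L_i U, a factor from U that appears after the
three letters moves through the steps of v₂ and disappears in 𝒢'; the steps of v₁ are just a factor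
on the left. For x < z one has L_x L_z ⊆ L_z L_x U (`lowerSteps_mul_lowerSteps_subset`), which gives
one inclusion of images for both Knuth relations. The opposite inclusion is obstructed by the
z-parameter of the step of type x. The third letter y removes it: explicit identities between triple
products absorb this parameter, always if two of the letters coincide, and otherwise if one further
parameter is nonzero. Where that parameter vanishes, the product is a limit of a family on which it
does not, and a Zariski closed set that contains the family contains the limit
(`ofGL_mem_of_shear`). So the images have the same closure. -/

namespace KnuthMV

open Matrix

/-! ### Elementary steps -/

section Shear

variable {n : ℕ} {R S : Type*} [CommRing R] [CommRing S]

/-- The matrix `1 + ∑_{l ≠ i} b_l E_{l i}`. -/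
def shear (i : Fin n) (b : Fin n → R) : SL(n, R) :=
  ⟨1 + vecMulVec (Function.update b i 0) (Pi.single i 1), by
    rw [vecMulVec_eq Unit, det_one_add_replicateCol_mul_replicateRow]
    simp⟩

theorem shear_mulVec (i : Fin n) (b v : Fin n → R) :
    (shear i b).1 *ᵥ v = v + v i • Function.update b i 0 := by
  change (1 + vecMulVec (Function.update b i 0) (Pi.single i 1)) *ᵥ v = _
  rw [add_mulVec, one_mulVec, vecMulVec_mulVec, single_one_dotProduct]
  simp

theorem shear_apply_ne (i : Fin n) (b : Fin n → R) {l m : Fin n} (h : m ≠ i) :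
    (shear i b).1 l m = (1 : Matrix (Fin n) (Fin n) R) l m := by
  simp [shear, vecMulVec_apply, h]

theorem shear_apply_self (i : Fin n) (b : Fin n → R) {l : Fin n} (h : l ≠ i) :
    (shear i b).1 l i = b l := by
  simp [shear, vecMulVec_apply, h]

theorem shear_apply_diag (i : Fin n) (b : Fin n → R) (l : Fin n) : (shear i b).1 l l = 1 := by
  by_cases h : l = i
  · subst h; simp [shear, vecMulVec_apply]
  · simp [shear_apply_ne i b h]

/-- The off-diagonal column has no `i`-component, so the product of the two rank-one parts vanishes.
-/
theorem shear_mul (i : Fin n) (b b' : Fin n → R) :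
    shear i b * shear i b' = shear i (b + b') := by
  refine Subtype.ext (Matrix.ext_of_mulVec_single fun m => ?_)
  change ((shear i b).1 * (shear i b').1) *ᵥ _ = _
  rw [← mulVec_mulVec, shear_mulVec, shear_mulVec, shear_mulVec]
  ext l
  by_cases h : l = i
  · subst h; simp
  · simp [h]; ring

@[simp]
theorem shear_zero (i : Fin n) : shear i (0 : Fin n → R) = 1 := by
  refine Subtype.ext ?_
  simp [shear]

theorem shear_inv (i : Fin n) (b : Fin n → R) : (shear i b)⁻¹ = shear i (-b) := by
  rw [inv_eq_iff_mul_eq_one, shear_mul, add_neg_cancel, shear_zero]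

theorem map_shear (f : R →+* S) (i : Fin n) (b : Fin n → R) :
    SpecialLinearGroup.map f (shear i b) = shear i (f ∘ b) := by
  refine Subtype.ext ?_
  ext l m
  change f ((shear i b).1 l m) = _
  by_cases hm : m = i
  · subst hm
    by_cases hl : l = m
    · subst hl; simp [shear_apply_diag]
    · simp [shear_apply_self _ _ hl]
  · simp [shear_apply_ne _ _ hm, Matrix.one_apply, apply_ite f]

end Shear

variable {n : ℕ}

/-- The inclusion `SL_n(ℂ) → SL_n(𝒪)`. -/
noncomputable def const (n : ℕ) : SL(n, ℂ) →* SL(n, ℂ⟦X⟧) := SpecialLinearGroup.map PowerSeries.C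

/-- The inclusion `SL_n(𝒪) → GL_n(𝒦)`. -/
noncomputable def integral (n : ℕ) : SL(n, ℂ⟦X⟧) →* GL (Fin n) ℂ⸨X⸩ :=
  SpecialLinearGroup.mapGL ℂ⸨X⸩

theorem const_apply (A : SL(n, ℂ)) (l m : Fin n) : (const n A).1 l m = PowerSeries.C (A.1 l m) :=
  rfl

theorem integral_apply (A : SL(n, ℂ⟦X⟧)) (l m : Fin n) :
    (integral n A).1 l m = HahnSeries.ofPowerSeries ℤ ℂ (A.1 l m) := by
  simp [integral]

theorem tPow_zero : tPow (0 : Fin n → ℤ) = 1 := by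
  ext i j
  simp [tPow, Matrix.one_apply]

theorem tPow_add (μ ν : Fin n → ℤ) : tPow (μ + ν) = tPow μ * tPow ν := by
  refine Units.ext ?_
  simp [tPow, Matrix.diagonal_mul_diagonal]

theorem tPow_neg (μ : Fin n → ℤ) : tPow (-μ) = (tPow μ)⁻¹ := by
  rw [eq_inv_iff_mul_eq_one, ← tPow_add, neg_add_cancel, tPow_zero]

/-- The matrix `(1 + ∑_{l ≠ i} b_l E_{l i}) t^{-ε_i}`. -/
noncomputable def elementaryStep (i : Fin n) (b : Fin n → ℂ) : GL (Fin n) ℂ⸨X⸩ :=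
  integral n (const n (shear i b)) * tPow (-Pi.single i 1)

theorem tPow_mulVec (μ : Fin n → ℤ) (v : Fin n → ℂ⸨X⸩) (l : Fin n) :
    ((tPow μ).1 *ᵥ v) l = HahnSeries.single (μ l) 1 * v l := by
  simp [tPow, Matrix.mulVec_diagonal]

theorem integral_const_shear (i : Fin n) (b : Fin n → ℂ) :
    (integral n (const n (shear i b))).1 = (shear i (HahnSeries.C (Γ := ℤ) ∘ b)).1 := by
  rw [← map_shear]
  ext l m : 1
  rw [integral_apply, const_apply, HahnSeries.ofPowerSeries_C]
  rfl

/-- E_i(b) is the identity plus a matrix supported in column `i`. With this formula the relations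
between steps below become polynomial identities that `ring` can check. -/
theorem elementaryStep_mulVec (i : Fin n) {b : Fin n → ℂ} (hb : b i = 0) (v : Fin n → ℂ⸨X⸩)
    (l : Fin n) : ((elementaryStep i b).1 *ᵥ v) l = v l + v i *
      (HahnSeries.single (-1) 1 * ((Pi.single i 1 : Fin n → ℂ⸨X⸩) l + HahnSeries.C (b l)) -
        (Pi.single i 1 : Fin n → ℂ⸨X⸩) l) := by
  rw [elementaryStep, Units.val_mul, ← mulVec_mulVec, integral_const_shear, shear_mulVec]
  have e : Function.update (HahnSeries.C (Γ := ℤ) ∘ b) i 0 = HahnSeries.C (Γ := ℤ) ∘ b := by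
    rw [Function.update_eq_self_iff]; simp [hb]
  rw [e, Pi.add_apply, Pi.smul_apply, tPow_mulVec, tPow_mulVec, smul_eq_mul, Function.comp_apply]
  by_cases h : l = i
  · subst h
    simp [hb]; ring
  · simp only [Pi.neg_apply, Pi.single_eq_same, Pi.single_eq_of_ne h, neg_zero,
      HahnSeries.single_zero_one, one_mul]
    ring

/-- Conjugation by `t^{ε_i}` of an integral matrix whose reduction fixes the line of `e_i` gives an
integral matrix. -/
theorem exists_integral_conj (Y : SL(n, ℂ⟦X⟧)) (i : Fin n)
    (hY : ∀ l, l ≠ i → PowerSeries.constantCoeff (Y.1 l i) = 0) :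
    ∃ h : SL(n, ℂ⟦X⟧),
      integral n Y * tPow (-Pi.single i 1) = tPow (-Pi.single i 1) * integral n h ∧
      h.1 = Matrix.of fun l m => if l = i then (if m = i then Y.1 l m else PowerSeries.X * Y.1 l m)
        else if m = i then PowerSeries.mk fun k => PowerSeries.coeff (k + 1) (Y.1 l m)
          else Y.1 l m := by
  set H : Matrix (Fin n) (Fin n) ℂ⟦X⟧ := Matrix.of fun l m =>
    if l = i then (if m = i then Y.1 l m else PowerSeries.X * Y.1 l m)
        else if m = i then PowerSeries.mk fun k => PowerSeries.coeff (k + 1) (Y.1 l m)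
          else Y.1 l m with hH
  have hT : (HahnSeries.single (-1) 1 : ℂ⸨X⸩) * HahnSeries.single 1 1 = 1 := by
    simp
  have key : (integral n Y).1 * (tPow (-Pi.single i 1)).1 =
      (tPow (-Pi.single i 1)).1 * H.map (algebraMap ℂ⟦X⟧ ℂ⸨X⸩) := by
    ext l m : 1
    simp only [tPow, Matrix.mul_diagonal, Matrix.diagonal_mul, integral_apply, Matrix.map_apply]
    change _ = _ * HahnSeries.ofPowerSeries ℤ ℂ (H l m)
    by_cases hl : l = i <;> by_cases hm : m = i
    · subst hl; subst hm
      simp [hH, mul_comm]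
    · subst hl
      simp only [hH, Matrix.of_apply, if_true, if_neg hm, map_mul, HahnSeries.ofPowerSeries_X]
      simp [hm, ← mul_assoc]
    · subst hm
      -- Only these entries get divided by t; the hypothesis on column `i` makes them divisible.
      have e : Y.1 l m = PowerSeries.X *
          PowerSeries.mk fun k => PowerSeries.coeff (k + 1) (Y.1 l m) := by
        rw [← PowerSeries.sub_const_eq_X_mul_shift, hY l hl, map_zero, sub_zero]
      simp only [hH, Matrix.of_apply, if_true, if_neg hl]
      nth_rewrite 1 [e]
      rw [map_mul, HahnSeries.ofPowerSeries_X]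
      simp [hl, mul_right_comm]
    · simp [hH, hl, hm]
  have hdet : H.det = 1 := by
    have h1 := congrArg Matrix.det key
    rw [det_mul, det_mul, mul_comm] at h1
    have h0 : (tPow (-Pi.single i 1) : GL (Fin n) ℂ⸨X⸩).1.det ≠ 0 :=
      ((Matrix.isUnit_iff_isUnit_det _).1 (Units.isUnit _)).ne_zero
    have h2 := mul_left_cancel₀ h0 h1
    have h3 : (integral n Y).1.det = 1 := by
      change (Y.1.map (algebraMap ℂ⟦X⟧ ℂ⸨X⸩)).det = 1
      rw [← RingHom.mapMatrix_apply, ← RingHom.map_det, Y.2, map_one]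
    rw [h3, ← RingHom.mapMatrix_apply, ← RingHom.map_det] at h2
    refine IsFractionRing.injective ℂ⟦X⟧ ℂ⸨X⸩ ?_
    rw [← h2, map_one]
  exact ⟨⟨H, hdet⟩, Units.ext key, rfl⟩

/-- A matrix that is integral after conjugation by `t^{-ε_i}` has a reduction fixing the line
of `e_i`. -/
theorem constantCoeff_eq_zero_of_conj {Y h : SL(n, ℂ⟦X⟧)} {i : Fin n}
    (H : integral n Y * tPow (-Pi.single i 1) = tPow (-Pi.single i 1) * integral n h)
    {l : Fin n} (hl : l ≠ i) : PowerSeries.constantCoeff (Y.1 l i) = 0 := by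
  have h1 := congrArg (fun g : GL (Fin n) ℂ⸨X⸩ => g.1 l i) H
  simp only [tPow, Units.val_mul, Matrix.mul_diagonal, Matrix.diagonal_mul, integral_apply] at h1
  have h2 := congrArg (fun f : ℂ⸨X⸩ => f.coeff (-1)) h1
  simp only [Pi.neg_apply, Pi.single_eq_same, Pi.single_eq_of_ne hl, HahnSeries.coeff_mul_single,
    HahnSeries.coeff_single_mul, PowerSeries.coeff_coe] at h2
  simpa using h2

end KnuthMV

namespace KnuthMV

open Matrix

variable {n : ℕ}

/-! ### Relations between elementary steps -/

theorem ext_of_mulVec {g g' : GL (Fin n) ℂ⸨X⸩} (h : ∀ v l, (g.1 *ᵥ v) l = (g'.1 *ᵥ v) l) :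
    g = g' :=
  Units.ext (Matrix.ext_of_mulVec_single fun _ => funext (h _))

theorem integral_const_shear_mulVec (i : Fin n) {b : Fin n → ℂ} (hb : b i = 0)
    (v : Fin n → ℂ⸨X⸩) (l : Fin n) :
    ((integral n (const n (shear i b))).1 *ᵥ v) l = v l + v i * HahnSeries.C (b l) := by
  rw [integral_const_shear, shear_mulVec]
  have e : Function.update (HahnSeries.C (Γ := ℤ) ∘ b) i 0 = HahnSeries.C (Γ := ℤ) ∘ b := by
    rw [Function.update_eq_self_iff]; simp [hb]
  rw [e]
  simp

theorem C_single (i l : Fin n) (c : ℂ) :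
    (HahnSeries.C ((Pi.single i c : Fin n → ℂ) l) : ℂ⸨X⸩) =
      HahnSeries.C c * (Pi.single i 1 : Fin n → ℂ⸨X⸩) l := by
  by_cases h : l = i
  · subst h; simp
  · simp [h]

/-- Neither step sees the direction that the other one rescales, because b_z = 0 and b'_x = 0. -/
theorem elementaryStep_comm {x z : Fin n} (hxz : x ≠ z) {b b' : Fin n → ℂ}
    (hbx : b x = 0) (hbz : b z = 0) (hbx' : b' x = 0) (hbz' : b' z = 0) :
    elementaryStep z b' * elementaryStep x b = elementaryStep x b * elementaryStep z b' := by
  refine ext_of_mulVec fun v l => ?_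
  simp only [Units.val_mul, ← mulVec_mulVec, elementaryStep_mulVec x hbx,
    elementaryStep_mulVec z hbz', hbz, hbx', map_zero, Pi.single_eq_of_ne hxz,
    Pi.single_eq_of_ne hxz.symm]
  ring

/-- E_z(b') sends e_z to t⁻¹(e_z + b'), a vector without x-component, which E_x(b) fixes. So adding
c e_z to the column of e_x on the right amounts to adding c (e_z + b') to the parameter b on the
left. -/
theorem elementaryStep_add_mul {x z : Fin n} (hxz : x ≠ z) {b b' : Fin n → ℂ}
    (hbx : b x = 0) (hbx' : b' x = 0) (hbz' : b' z = 0) (c : ℂ) :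
    elementaryStep x (b + c • (Pi.single z 1 + b')) * elementaryStep z b' =
      elementaryStep x b * elementaryStep z b' *
        integral n (const n (shear x (Pi.single z c))) := by
  refine ext_of_mulVec fun v l => ?_
  have h1 : (b + c • (Pi.single z 1 + b') : Fin n → ℂ) x = 0 := by simp [hbx, hbx', hxz]
  have h2 : (Pi.single z c : Fin n → ℂ) x = 0 := by simp [hxz]
  simp only [Units.val_mul, ← mulVec_mulVec, elementaryStep_mulVec x hbx,
    elementaryStep_mulVec x h1, integral_const_shear_mulVec x h2,
    elementaryStep_mulVec z hbz', hbx', h2, map_zero, Pi.single_eq_of_ne hxz,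
    Pi.single_eq_same, Pi.add_apply, Pi.smul_apply, smul_eq_mul,
    map_add, map_mul, C_single, map_one]
  ring

/-- Changing the parameter of the first step by ρ(e_z + b') is felt by e_x only through the
y-component of b''. On the right-hand side this shows up as the z-parameter ρ b''_y of the step of
type x, which therefore is arbitrary as soon as b''_y ≠ 0. -/
theorem elementaryStep_yzx {x y z : Fin n} (hxy : x ≠ y) (hxz : x ≠ z) (hyz : y ≠ z)
    {b b' b'' : Fin n → ℂ} (hby : b y = 0) (hbx' : b' x = 0) (hby' : b' y = 0)
    (hbz' : b' z = 0) (hbx'' : b'' x = 0) (hbz'' : b'' z = 0) (ρ : ℂ) :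
    elementaryStep y (b + ρ • (Pi.single z 1 + b')) * elementaryStep x b'' * elementaryStep z b' =
      elementaryStep y b * elementaryStep z b' *
        elementaryStep x (b'' + Pi.single z (ρ * b'' y)) *
          integral n (const n (shear y (Pi.single z ρ))) := by
  refine ext_of_mulVec fun v l => ?_
  have h1 : (b + ρ • (Pi.single z 1 + b') : Fin n → ℂ) y = 0 := by simp [hby, hby', hyz]
  have h2 : (Pi.single z ρ : Fin n → ℂ) y = 0 := by simp [hyz]
  have h3 : (b'' + Pi.single z (ρ * b'' y) : Fin n → ℂ) x = 0 := by simp [hbx'', hxz]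
  simp only [Units.val_mul, ← mulVec_mulVec, elementaryStep_mulVec y hby,
    elementaryStep_mulVec y h1, integral_const_shear_mulVec y h2, elementaryStep_mulVec x h3,
    elementaryStep_mulVec x hbx'',
    elementaryStep_mulVec z hbz', hbx', hby', hbz'', map_zero,
    Pi.single_eq_of_ne hxz, Pi.single_eq_of_ne hxy.symm,
    Pi.single_eq_of_ne hyz, Pi.single_eq_of_ne hxz.symm, Pi.single_eq_same, Pi.add_apply, Pi.smul_apply, smul_eq_mul,
    map_add, map_mul, C_single, map_one]
  ring

/-- The case x = y of the preceding relation. The coefficient of e_y in e_y + b'' is 1, which takes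
the place of b''_y, so no parameter has to be nonzero. -/
theorem elementaryStep_yzy {y z : Fin n} (hyz : y ≠ z)
    {b b' b'' : Fin n → ℂ} (hby : b y = 0) (hby' : b' y = 0)
    (hbz' : b' z = 0) (hby'' : b'' y = 0) (hbz'' : b'' z = 0) (ζ : ℂ) :
    elementaryStep y (b + ζ • (Pi.single z 1 + b')) * elementaryStep y b'' * elementaryStep z b' =
      elementaryStep y b * elementaryStep z b' * elementaryStep y (b'' + Pi.single z ζ) := by
  refine ext_of_mulVec fun v l => ?_
  have h1 : (b + ζ • (Pi.single z 1 + b') : Fin n → ℂ) y = 0 := by simp [hby, hby', hyz]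
  have h3 : (b'' + Pi.single z ζ : Fin n → ℂ) y = 0 := by simp [hby'', hyz]
  simp only [Units.val_mul, ← mulVec_mulVec, elementaryStep_mulVec y hby,
    elementaryStep_mulVec y h1, elementaryStep_mulVec y h3,
    elementaryStep_mulVec y hby'',
    elementaryStep_mulVec z hbz', hby', hby'', hbz'', map_zero,
    Pi.single_eq_of_ne hyz, Pi.single_eq_of_ne hyz.symm,
    Pi.single_eq_same, Pi.add_apply, Pi.smul_apply, smul_eq_mul,
    map_add, map_mul, C_single, map_one]
  ring

/-- On e_x, the shear on the right creates ρ e_y, which the step of type y turns into ρ t⁻¹(e_y +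
b''). Its z-component accounts for the z-parameter of the middle step on the left; the remaining
part is cancelled by the parameter of the first step on the right. -/
theorem elementaryStep_zxy {x y z : Fin n} (hxy : x ≠ y) (hxz : x ≠ z) (hyz : y ≠ z)
    {b b' b'' : Fin n → ℂ} (hbx : b x = 0) (hbz : b z = 0) (hbx' : b' x = 0)
    (hbz' : b' z = 0) (hbx'' : b'' x = 0) (hby'' : b'' y = 0) (ρ : ℂ) :
    elementaryStep z b * elementaryStep x (b' + Pi.single z (ρ * b'' z)) * elementaryStep y b'' =
      elementaryStep x (b' - ρ • (Pi.single y 1 + b'' - Pi.single z (b'' z))) *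
        elementaryStep z b * elementaryStep y b'' *
          integral n (const n (shear x (Pi.single y ρ))) := by
  refine ext_of_mulVec fun v l => ?_
  have h1 : (b' - ρ • (Pi.single y 1 + b'' - Pi.single z (b'' z)) : Fin n → ℂ) x = 0 := by
    simp [hbx', hbx'', hxy, hxz]
  have h2 : (Pi.single y ρ : Fin n → ℂ) x = 0 := by simp [hxy]
  have h3 : (b' + Pi.single z (ρ * b'' z) : Fin n → ℂ) x = 0 := by simp [hbx', hxz]
  simp only [Units.val_mul, ← mulVec_mulVec, elementaryStep_mulVec y hby'',
    elementaryStep_mulVec x h1, integral_const_shear_mulVec x h2, elementaryStep_mulVec x h3,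
    elementaryStep_mulVec z hbz, hbz', hbx, hbx'', map_zero,
    Pi.single_eq_of_ne hxz, Pi.single_eq_of_ne hxy, Pi.single_eq_of_ne hyz.symm,
    Pi.single_eq_of_ne hxz.symm, Pi.single_eq_same, Pi.add_apply, Pi.smul_apply, Pi.sub_apply,
    smul_eq_mul, map_add, map_sub, map_mul, C_single, map_one]
  ring

/-- The case y = z of the preceding relation, where the coefficient 1 of e_z in e_z + b'' replaces
b''_z. -/
theorem elementaryStep_zxz {x z : Fin n} (hxz : x ≠ z)
    {b b' b'' : Fin n → ℂ} (hbx : b x = 0) (hbz : b z = 0) (hbx' : b' x = 0)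
    (hbz' : b' z = 0) (hbx'' : b'' x = 0) (hbz'' : b'' z = 0) (ζ : ℂ) :
    elementaryStep z b * elementaryStep x (b' + Pi.single z ζ) * elementaryStep z b'' =
      elementaryStep x (b' - ζ • b'') * elementaryStep z b * elementaryStep z b'' *
          integral n (const n (shear x (Pi.single z ζ))) := by
  refine ext_of_mulVec fun v l => ?_
  have h1 : (b' - ζ • b'' : Fin n → ℂ) x = 0 := by simp [hbx', hbx'']
  have h2 : (Pi.single z ζ : Fin n → ℂ) x = 0 := by simp [hxz]
  have h3 : (b' + Pi.single z ζ : Fin n → ℂ) x = 0 := by simp [hbx', hxz]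
  simp only [Units.val_mul, ← mulVec_mulVec, elementaryStep_mulVec z hbz'',
    elementaryStep_mulVec x h1, integral_const_shear_mulVec x h2, elementaryStep_mulVec x h3,
    elementaryStep_mulVec z hbz, hbz', hbx, hbx'', hbz'', map_zero,
    Pi.single_eq_of_ne hxz,
    Pi.single_eq_of_ne hxz.symm, Pi.single_eq_same, Pi.add_apply, Pi.smul_apply, Pi.sub_apply,
    smul_eq_mul, map_add, map_sub, map_mul, C_single]
  ring

/-! ### Products of elementary steps and lower unipotent matrices -/

/-- `A` is lower triangular with ones on the diagonal. -/
def IsLowerUnipotent (A : SL(n, ℂ⟦X⟧)) : Prop :=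
  (∀ l, A.1 l l = 1) ∧ ∀ l m, l < m → A.1 l m = 0

theorem IsLowerUnipotent.mul {A B : SL(n, ℂ⟦X⟧)} (hA : IsLowerUnipotent A)
    (hB : IsLowerUnipotent B) : IsLowerUnipotent (A * B) := by
  refine ⟨fun l => ?_, fun l m hlm => ?_⟩
  · change (A.1 * B.1) l l = 1
    rw [Matrix.mul_apply, Finset.sum_eq_single l, hA.1, hB.1, mul_one]
    · intro k _ hk
      rcases lt_or_gt_of_ne hk with h | h
      · rw [hB.2 _ _ h, mul_zero]
      · rw [hA.2 _ _ h, zero_mul]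
    · simp
  · change (A.1 * B.1) l m = 0
    rw [Matrix.mul_apply]
    refine Finset.sum_eq_zero fun k _ => ?_
    rcases lt_or_ge l k with h | h
    · rw [hA.2 _ _ h, zero_mul]
    · rw [hB.2 _ _ (h.trans_lt hlm), mul_zero]

theorem isLowerUnipotent_const_shear {i : Fin n} {b : Fin n → ℂ} (hb : ∀ l ≤ i, b l = 0) :
    IsLowerUnipotent (const n (shear i b)) := by
  refine ⟨fun l => ?_, fun l m hlm => ?_⟩
  · rw [const_apply, shear_apply_diag, map_one]
  · rw [const_apply]
    by_cases hm : m = i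
    · subst hm
      rw [shear_apply_self _ _ hlm.ne, hb l hlm.le, map_zero]
    · rw [shear_apply_ne _ _ hm, Matrix.one_apply_ne hlm.ne, map_zero]

/-- The subset of `GL_n(𝒦)` of the lower unipotent matrices with entries in `𝒪`. -/
def lowerUnipotents (n : ℕ) : Set (GL (Fin n) ℂ⸨X⸩) := integral n '' {A | IsLowerUnipotent A}

/-- The elementary steps of type `i` with a lower triangular matrix. -/
def lowerSteps (i : Fin n) : Set (GL (Fin n) ℂ⸨X⸩) :=
  {g | ∃ b : Fin n → ℂ, (∀ l ≤ i, b l = 0) ∧ g = elementaryStep i b}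

open scoped Pointwise in
/-- The products of lower triangular elementary steps whose types are the letters of `w`. -/
def lowerProducts (w : List (Fin n)) : Set (GL (Fin n) ℂ⸨X⸩) := (w.map lowerSteps).prod

open scoped Pointwise

theorem lowerProducts_append (v w : List (Fin n)) :
    lowerProducts (v ++ w) = lowerProducts v * lowerProducts w := by
  simp [lowerProducts]

theorem lowerProducts_cons (i : Fin n) (w : List (Fin n)) :
    lowerProducts (i :: w) = lowerSteps i * lowerProducts w := by
  simp [lowerProducts]

theorem lowerProducts_singleton (i : Fin n) : lowerProducts [i] = lowerSteps i := by
  simp [lowerProducts]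

theorem constantCoeff_col (A : SL(n, ℂ⟦X⟧)) (b : Fin n → ℂ) (i l : Fin n) :
    PowerSeries.constantCoeff ((const n (shear i (-b)) * A).1 l i) =
      PowerSeries.constantCoeff (A.1 l i) -
        PowerSeries.constantCoeff (A.1 i i) * Function.update b i 0 l := by
  have h := congrFun (shear_mulVec i (-b) fun m => PowerSeries.constantCoeff (A.1 m i)) l
  have e : PowerSeries.constantCoeff ((const n (shear i (-b)) * A).1 l i) =
      ((shear i (-b)).1 *ᵥ fun m => PowerSeries.constantCoeff (A.1 m i)) l := by
    change PowerSeries.constantCoeff (((const n (shear i (-b))).1 * A.1) l i) = _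
    simp [Matrix.mul_apply, const_apply, Matrix.mulVec, dotProduct]
  rw [e, h, Pi.add_apply, Pi.smul_apply, smul_eq_mul]
  by_cases hl : l = i
  · subst hl; simp
  · simp [hl]; ring

/-- The constant terms below the diagonal in column `i` become the parameters of a new step. What is
left fixes e_i modulo t, and its conjugate by t^{ε_i} is again integral and lower unipotent. -/
theorem lowerUnipotents_mul_lowerSteps (i : Fin n) :
    lowerUnipotents n * lowerSteps i ⊆ lowerSteps i * lowerUnipotents n := by
  rintro _ ⟨_, ⟨A, hA, rfl⟩, _, ⟨b, hb, rfl⟩, rfl⟩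
  have hB := IsLowerUnipotent.mul hA (isLowerUnipotent_const_shear hb)
  set B := A * const n (shear i b) with hBdef
  let b' : Fin n → ℂ := fun l => if l ≤ i then 0 else PowerSeries.constantCoeff (B.1 l i)
  have hb' : ∀ l ≤ i, b' l = 0 := fun l hl => if_pos hl
  have hY : ∀ l, l ≠ i →
      PowerSeries.constantCoeff ((const n (shear i (-b')) * B).1 l i) = 0 := by
    intro l hl
    rw [constantCoeff_col, hB.1, map_one, one_mul, Function.update_of_ne hl]
    rcases lt_or_gt_of_ne hl with h | h
    · rw [hB.2 _ _ h, hb' l h.le]; simp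
    · simp [b', h.not_ge]
  have hYu : IsLowerUnipotent (const n (shear i (-b')) * B) :=
    (isLowerUnipotent_const_shear fun l hl => by simp [hb' l hl]).mul hB
  obtain ⟨h, h1, h2⟩ := exists_integral_conj _ i hY
  refine ⟨_, ⟨b', hb', rfl⟩, _, ⟨h, ⟨fun l => ?_, fun l m hlm => ?_⟩, rfl⟩, ?_⟩
  · rw [h2, Matrix.of_apply]
    by_cases hl : l = i
    · rw [if_pos hl, if_pos hl, hYu.1]
    · rw [if_neg hl, if_neg hl, hYu.1]
  · rw [h2, Matrix.of_apply, hYu.2 l m hlm]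
    split_ifs <;> first | rfl | simp
  · change elementaryStep i b' * integral n h = integral n A * elementaryStep i b
    have e : const n (shear i b') * (const n (shear i (-b')) * B) = B := by
      rw [← mul_assoc, ← map_mul, shear_mul, add_neg_cancel, shear_zero, map_one, one_mul]
    rw [elementaryStep, elementaryStep, mul_assoc, ← h1, ← mul_assoc, ← map_mul, e, hBdef,
      map_mul, mul_assoc]

theorem lowerUnipotents_mul_lowerProducts (w : List (Fin n)) :
    lowerUnipotents n * lowerProducts w ⊆ lowerProducts w * lowerUnipotents n := by
  induction w with
  | nil => simp [lowerProducts]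
  | cons i w ih =>
    rw [lowerProducts_cons, ← mul_assoc, mul_assoc (lowerSteps i)]
    refine (Set.mul_subset_mul_right (lowerUnipotents_mul_lowerSteps i)).trans ?_
    rw [mul_assoc]
    exact Set.mul_subset_mul_left ih

theorem ofGL_mul_integral (g : GL (Fin n) ℂ⸨X⸩) (A : SL(n, ℂ⟦X⟧)) :
    AffineGrassmannian.ofGL (g * integral n A) = AffineGrassmannian.ofGL g := by
  refine (QuotientGroup.eq.2 ?_).symm
  refine ⟨SpecialLinearGroup.toGL A, ?_⟩
  rw [← map_inv, ← map_mul, inv_mul_cancel_left]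
  exact congrArg (ProjGenLinGroup.mk (n := Fin n) (R := ℂ⸨X⸩)) (Units.ext rfl)

/-- Unipotent factors in front of a suffix are invisible in 𝒢'. This allows computing with three
letters modulo `lowerUnipotents n`. -/
theorem ofGL_image_mul_lowerProducts_subset {S : Set (GL (Fin n) ℂ⸨X⸩)}
    {g : GL (Fin n) ℂ⸨X⸩} (w : List (Fin n))
    (hg : g ∈ S * lowerUnipotents n * lowerProducts w) :
    AffineGrassmannian.ofGL g ∈ AffineGrassmannian.ofGL '' (S * lowerProducts w) := by
  rw [mul_assoc] at hg
  have := Set.mul_subset_mul_left (lowerUnipotents_mul_lowerProducts w) hg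
  rw [← mul_assoc] at this
  obtain ⟨h, hh, _, ⟨A, -, rfl⟩, rfl⟩ := this
  exact ⟨h, hh, (ofGL_mul_integral h A).symm⟩

end KnuthMV

namespace KnuthMV

open Matrix

variable {n : ℕ}

/-! ### Zariski limits along one-parameter families -/

/-- Unwinds the coinduced and induced topologies: on each bounded piece, membership in a closed set
is a system of polynomial equations in the Laurent coefficients. -/
theorem isClosed_ofGL_preimage {Z : Set (AffineGrassmannian n)} (hZ : IsClosed Z) (a : ℕ) :
    ∃ s : Set (MvPolynomial ((Fin n × Fin n × ℤ) ⊕ (Fin n × Fin n × ℤ)) ℂ),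
      ∀ g ∈ boundedGL n a, AffineGrassmannian.ofGL g ∈ Z ↔
        ∀ p ∈ s, MvPolynomial.eval (coordinates g) p = 0 := by
  have h1 : IsClosed[zariskiGL n] (AffineGrassmannian.ofGL ⁻¹' Z) := isClosed_coinduced.1 hZ
  have h2 := isClosed_coinduced.1 (isClosed_iSup_iff.1 h1 a)
  obtain ⟨T, hT, hT'⟩ := (@isClosed_induced_iff _ _ (zariski _) _ _).1 h2
  obtain ⟨U, hU, rfl⟩ := isClosed_induced_iff.1 hT
  obtain ⟨s, rfl⟩ := (PrimeSpectrum.isClosed_iff_zeroLocus _).1 hU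
  refine ⟨s, fun g hg => ?_⟩
  have h3 := congrArg (fun S : Set (boundedGL n a) => (⟨g, hg⟩ : boundedGL n a) ∈ S) hT'
  simp only [Set.mem_preimage, PrimeSpectrum.mem_zeroLocus, eq_iff_iff] at h3
  rw [← h3]
  refine forall₂_congr fun p _ => ?_
  exact MvPolynomial.mem_vanishingIdeal_singleton_iff _ _

theorem exists_le_coeff_eq_zero {ι : Type*} [Finite ι] (f : ι → ℂ⸨X⸩) :
    ∃ a : ℕ, ∀ i, ∀ k : ℤ, k < -(a : ℤ) → (f i).coeff k = 0 := by
  cases nonempty_fintype ι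
  refine ⟨∑ i, (f i).order.natAbs, fun i k hk => HahnSeries.coeff_eq_zero_of_lt_order ?_⟩
  have h : (f i).order.natAbs ≤ ∑ i, (f i).order.natAbs :=
    Finset.single_le_sum (f := fun i => (f i).order.natAbs) (fun _ _ => Nat.zero_le _)
      (Finset.mem_univ i)
  omega

theorem integral_const_shear_smul (i : Fin n) (b : Fin n → ℂ) (z : ℂ) :
    (integral n (const n (shear i (z • b)))).1 =
      1 + Matrix.scalar (Fin n) (HahnSeries.C (Γ := ℤ) z) * ((integral n (const n (shear i b))).1 - 1) := by
  rw [integral_const_shear, integral_const_shear]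
  ext l m : 1
  by_cases hm : m = i
  · subst hm
    by_cases hl : l = m
    · subst hl; simp [shear_apply_diag, Matrix.diagonal_mul]
    · simp [shear_apply_self _ _ hl, hl, Matrix.diagonal_mul]
  · simp [shear_apply_ne _ _ hm, Matrix.diagonal_mul]

/-- A closed subset of the affine Grassmannian that contains the points of a one-parameter family
for `z ≠ 0` contains the point for `z = 0`. -/
theorem ofGL_mem_of_shear {Z : Set (AffineGrassmannian n)} (hZ : IsClosed Z)
    (A B : GL (Fin n) ℂ⸨X⸩) (i : Fin n) (b : Fin n → ℂ)
    (h : ∀ z : ℂ, z ≠ 0 →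
      AffineGrassmannian.ofGL (A * integral n (const n (shear i (z • b))) * B) ∈ Z) :
    AffineGrassmannian.ofGL (A * B) ∈ Z := by
  let g : ℂ → GL (Fin n) ℂ⸨X⸩ := fun z => A * integral n (const n (shear i (z • b))) * B
  let M := (integral n (const n (shear i b))).1 - 1
  let v₀ : (Fin n × Fin n × ℤ) ⊕ (Fin n × Fin n × ℤ) → ℂ :=
    Sum.elim (fun v => ((A.1 * B.1) v.1 v.2.1).coeff v.2.2)
      (fun v => ((B⁻¹.1 * A⁻¹.1) v.1 v.2.1).coeff v.2.2)
  let v₁ : (Fin n × Fin n × ℤ) ⊕ (Fin n × Fin n × ℤ) → ℂ :=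
    Sum.elim (fun v => ((A.1 * M * B.1) v.1 v.2.1).coeff v.2.2)
      (fun v => -((B⁻¹.1 * M * A⁻¹.1) v.1 v.2.1).coeff v.2.2)
  have hc : ∀ (z : ℂ) (Y W : Matrix (Fin n) (Fin n) ℂ⸨X⸩),
      Y * (Matrix.scalar (Fin n) (HahnSeries.C (Γ := ℤ) z) * W) =
        Matrix.scalar (Fin n) (HahnSeries.C (Γ := ℤ) z) * (Y * W) := fun z Y W => by
    rw [← mul_assoc, ← (Matrix.scalar_commute _ (fun _ => Commute.all _ _) Y).eq, mul_assoc]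
  -- Every coordinate is affine linear in z. For the coordinates of the inverse this holds because
  -- the inverse of the shear with parameter z b is the shear with parameter -z b.
  have hg : ∀ z, coordinates (g z) = fun v => v₀ v + z * v₁ v := by
    intro z
    have e1 : (g z).1 = A.1 * B.1 + Matrix.scalar (Fin n) (HahnSeries.C (Γ := ℤ) z) * (A.1 * M * B.1) := by
      change A.1 * (integral n (const n (shear i (z • b)))).1 * B.1 = _
      rw [integral_const_shear_smul, mul_add, add_mul, mul_one, hc, mul_assoc (Matrix.scalar _ _)]
    have e2 : (g z)⁻¹.1 = B⁻¹.1 * A⁻¹.1 -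
        Matrix.scalar (Fin n) (HahnSeries.C (Γ := ℤ) z) * (B⁻¹.1 * M * A⁻¹.1) := by
      have e : (g z)⁻¹ = B⁻¹ * integral n (const n (shear i ((-z) • b))) * A⁻¹ := by
        change (A * _ * B)⁻¹ = _
        rw [_root_.mul_inv_rev, _root_.mul_inv_rev, ← map_inv, ← map_inv, shear_inv, neg_smul,
          mul_assoc]
      rw [e]
      change B⁻¹.1 * (integral n (const n (shear i ((-z) • b)))).1 * A⁻¹.1 = _
      rw [integral_const_shear_smul, mul_add, add_mul, mul_one, hc, mul_assoc (Matrix.scalar _ _),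
        map_neg, map_neg, neg_mul, ← sub_eq_add_neg]
    funext v
    rcases v with v | v
    · simp [coordinates, v₀, v₁, e1, Matrix.diagonal_mul]
    · simp [coordinates, v₀, v₁, e2, Matrix.diagonal_mul]
      ring
  -- One pole bound for the four coefficient matrices of the family and of its inverse puts the
  -- whole family into a single bounded piece.
  obtain ⟨a, ha⟩ := exists_le_coeff_eq_zero
    (fun p : Bool × Bool × Fin n × Fin n => cond p.1
      (cond p.2.1 ((A.1 * B.1) p.2.2.1 p.2.2.2) ((A.1 * M * B.1) p.2.2.1 p.2.2.2))
      (cond p.2.1 ((B⁻¹.1 * A⁻¹.1) p.2.2.1 p.2.2.2) ((B⁻¹.1 * M * A⁻¹.1) p.2.2.1 p.2.2.2)))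
  have hbd : ∀ z, g z ∈ boundedGL n a := by
    intro z l m k hk
    have c1 := congrFun (hg z) (Sum.inl (l, m, k))
    have c2 := congrFun (hg z) (Sum.inr (l, m, k))
    have a1 := ha (true, true, l, m) k hk
    have a2 := ha (true, false, l, m) k hk
    have a3 := ha (false, true, l, m) k hk
    have a4 := ha (false, false, l, m) k hk
    simp only [coordinates, Sum.elim_inl, Sum.elim_inr, v₀, v₁, cond_true, cond_false]
      at c1 c2 a1 a2 a3 a4
    rw [c1, c2, a1, a2, a3, a4]
    simp
  obtain ⟨s, hs⟩ := isClosed_ofGL_preimage hZ a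
  have g0 : g 0 = A * B := by simp [g]
  rw [← g0, hs _ (hbd 0)]
  intro p hp
  let q : Polynomial ℂ :=
    MvPolynomial.aeval (fun v => Polynomial.C (v₀ v) + Polynomial.X * Polynomial.C (v₁ v)) p
  have hq : ∀ z, q.eval z = MvPolynomial.eval (coordinates (g z)) p := by
    intro z
    rw [hg]
    change Polynomial.eval z (MvPolynomial.aeval _ p) = _
    clear hp q
    induction p using MvPolynomial.induction_on with
    | C c => simp
    | add p p' hp hp' => rw [map_add, map_add, Polynomial.eval_add, hp, hp']
    | mul_X p v hp =>
      rw [map_mul, map_mul, Polynomial.eval_mul, hp]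
      simp [mul_comm z]
  -- A polynomial in z that vanishes for all z ≠ 0 is zero.
  have hq0 : q = 0 := by
    refine Polynomial.eq_zero_of_infinite_isRoot q (Set.Infinite.mono (s := {0}ᶜ) ?_ ?_)
    · intro z hz
      change q.eval z = 0
      rw [hq]
      exact (hs _ (hbd z)).1 (h z hz) p hp
    · exact (Set.finite_singleton (0 : ℂ)).infinite_compl
  rw [← hq, hq0, Polynomial.eval_zero]

end KnuthMV

namespace KnuthMV

open Matrix
open scoped Pointwise

variable {n : ℕ}

/-! ### Knuth relations and products of elementary steps -/

theorem integral_shear_mul_elementaryStep (i : Fin n) (b b' : Fin n → ℂ) :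
    integral n (const n (shear i b)) * elementaryStep i b' = elementaryStep i (b + b') := by
  rw [elementaryStep, elementaryStep, ← mul_assoc, ← map_mul, ← map_mul, shear_mul]

theorem integral_shear_single_mem {x z : Fin n} (h : x < z) (c : ℂ) :
    integral n (const n (shear x (Pi.single z c))) ∈ lowerUnipotents n :=
  ⟨_, isLowerUnipotent_const_shear fun _ hl => Pi.single_eq_of_ne (hl.trans_lt h).ne _, rfl⟩

theorem lowerSteps_mul_lowerSteps_subset {x z : Fin n} (h : x < z) :
    lowerSteps x * lowerSteps z ⊆ lowerSteps z * lowerSteps x * lowerUnipotents n := by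
  rintro _ ⟨_, ⟨b, hb, rfl⟩, _, ⟨b', hb', rfl⟩, rfl⟩
  -- Chosen such that b₀ has z-component 0 (as b'_z = 0), which is what makes the steps commute; the
  -- shear splits off by `elementaryStep_add_mul`.
  set b₀ : Fin n → ℂ := b - b z • (Pi.single z 1 + b') with hb₀
  have h0 : ∀ l ≤ x, b₀ l = 0 := fun l hl => by
    simp [hb₀, hb l hl, hb' l (hl.trans h.le), (hl.trans_lt h).ne]
  have e := elementaryStep_add_mul h.ne (h0 x le_rfl) (hb' x h.le) (hb' z le_rfl) (b z)
  rw [hb₀, sub_add_cancel, ← hb₀, ← elementaryStep_comm h.ne (h0 x le_rfl)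
    (by simp [hb₀, hb' z le_rfl]) (hb' x h.le) (hb' z le_rfl)] at e
  exact ⟨_, ⟨_, ⟨b', hb', rfl⟩, _, ⟨b₀, h0, rfl⟩, rfl⟩, _, integral_shear_single_mem h _, e.symm⟩

/-- With ρ = b''_z / b''_y, the relation `elementaryStep_yzx` produces exactly the z-parameter of
b''; its shear is moved to the other side. -/
theorem step_mem_yxz {x y z : Fin n} (hxy : x < y) (hyz : y < z) {b b' b'' : Fin n → ℂ}
    (hb : ∀ l ≤ y, b l = 0) (hb' : ∀ l ≤ z, b' l = 0) (hb'' : ∀ l ≤ x, b'' l = 0)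
    (hy : b'' y ≠ 0) :
    elementaryStep y b * elementaryStep z b' * elementaryStep x b'' ∈
      lowerSteps y * lowerSteps x * lowerSteps z * lowerUnipotents n := by
  have hxz := hxy.trans hyz
  set b₀ : Fin n → ℂ := b'' - Pi.single z (b'' z) with hb₀
  have h0 : ∀ l ≤ x, b₀ l = 0 := fun l hl => by simp [hb₀, hb'' l hl, (hl.trans_lt hxz).ne]
  have hy0 : b₀ y = b'' y := by simp [hb₀, hyz.ne]
  have e := elementaryStep_yzx hxy.ne hxz.ne hyz.ne (hb y le_rfl)
    (hb' x hxz.le) (hb' y hyz.le) (hb' z le_rfl) (h0 x le_rfl) (by simp [hb₀]) (b'' z / b'' y)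
  rw [hy0, div_mul_cancel₀ _ hy] at e
  nth_rewrite 2 [hb₀] at e
  rw [sub_add_cancel] at e
  refine ⟨_, ⟨_, ⟨_, ⟨b + (b'' z / b'' y) • (Pi.single z 1 + b'), fun l hl => ?_, rfl⟩,
    _, ⟨b₀, h0, rfl⟩, rfl⟩, _, ⟨b', hb', rfl⟩, rfl⟩, _, integral_shear_single_mem hyz (-(b'' z / b'' y)), ?_⟩
  · simp [hb l hl, hb' l (hl.trans hyz.le), (hl.trans_lt hyz).ne]
  · dsimp only
    rw [e, mul_assoc, ← map_mul, ← map_mul, shear_mul, ← Pi.single_add, add_neg_cancel,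
      Pi.single_zero, shear_zero, map_one, map_one, mul_one]

theorem step_mem_yyz {y z : Fin n} (hyz : y < z) {b b' b'' : Fin n → ℂ}
    (hb : ∀ l ≤ y, b l = 0) (hb' : ∀ l ≤ z, b' l = 0) (hb'' : ∀ l ≤ y, b'' l = 0) :
    elementaryStep y b * elementaryStep z b' * elementaryStep y b'' ∈
      lowerSteps y * lowerSteps y * lowerSteps z := by
  set b₀ : Fin n → ℂ := b'' - Pi.single z (b'' z) with hb₀
  have h0 : ∀ l ≤ y, b₀ l = 0 := fun l hl => by simp [hb₀, hb'' l hl, (hl.trans_lt hyz).ne]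
  have e := elementaryStep_yzy hyz.ne (hb y le_rfl)
    (hb' y hyz.le) (hb' z le_rfl) (h0 y le_rfl) (by simp [hb₀]) (b'' z)
  nth_rewrite 2 [hb₀] at e
  rw [sub_add_cancel] at e
  rw [← e]
  refine ⟨_, ⟨_, ⟨_, fun l hl => ?_, rfl⟩, _, ⟨b₀, h0, rfl⟩, rfl⟩, _, ⟨b', hb', rfl⟩, rfl⟩
  simp [hb l hl, hb' l (hl.trans hyz.le), (hl.trans_lt hyz).ne]

/-- With ρ = b'_z / b''_z, the relation `elementaryStep_zxy` absorbs exactly the z-parameter of b'.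
-/
theorem step_mem_xzy {x y z : Fin n} (hxy : x < y) (hyz : y < z) {b b' b'' : Fin n → ℂ}
    (hb : ∀ l ≤ z, b l = 0) (hb' : ∀ l ≤ x, b' l = 0) (hb'' : ∀ l ≤ y, b'' l = 0)
    (hz : b'' z ≠ 0) :
    elementaryStep z b * elementaryStep x b' * elementaryStep y b'' ∈
      lowerSteps x * lowerSteps z * lowerSteps y * lowerUnipotents n := by
  have hxz := hxy.trans hyz
  set b₀ : Fin n → ℂ := b' - Pi.single z (b' z) with hb₀
  have h0 : ∀ l ≤ x, b₀ l = 0 := fun l hl => by simp [hb₀, hb' l hl, (hl.trans_lt hxz).ne]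
  have e := elementaryStep_zxy hxy.ne hxz.ne hyz.ne (hb x hxz.le) (hb z le_rfl)
    (h0 x le_rfl) (by simp [hb₀]) (hb'' x hxy.le) (hb'' y le_rfl) (b' z / b'' z)
  rw [div_mul_cancel₀ _ hz] at e
  nth_rewrite 1 [hb₀] at e
  rw [sub_add_cancel] at e
  rw [e]
  refine ⟨_, ⟨_, ⟨_, ⟨_, fun l hl => ?_, rfl⟩, _, ⟨b, hb, rfl⟩, rfl⟩, _, ⟨b'', hb'', rfl⟩, rfl⟩, _,
    integral_shear_single_mem hxy _, rfl⟩
  simp [h0 l hl, hb'' l (hl.trans hxy.le), (hl.trans_lt hxy).ne, (hl.trans_lt hxz).ne]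

theorem step_mem_xzz {x z : Fin n} (hxz : x < z) {b b' b'' : Fin n → ℂ}
    (hb : ∀ l ≤ z, b l = 0) (hb' : ∀ l ≤ x, b' l = 0) (hb'' : ∀ l ≤ z, b'' l = 0) :
    elementaryStep z b * elementaryStep x b' * elementaryStep z b'' ∈
      lowerSteps x * lowerSteps z * lowerSteps z * lowerUnipotents n := by
  set b₀ : Fin n → ℂ := b' - Pi.single z (b' z) with hb₀
  have h0 : ∀ l ≤ x, b₀ l = 0 := fun l hl => by simp [hb₀, hb' l hl, (hl.trans_lt hxz).ne]
  have e := elementaryStep_zxz hxz.ne (hb x hxz.le) (hb z le_rfl)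
    (h0 x le_rfl) (by simp [hb₀]) (hb'' x hxz.le) (hb'' z le_rfl) (b' z)
  nth_rewrite 1 [hb₀] at e
  rw [sub_add_cancel] at e
  rw [e]
  refine ⟨_, ⟨_, ⟨_, ⟨_, fun l hl => ?_, rfl⟩, _, ⟨b, hb, rfl⟩, rfl⟩, _, ⟨b'', hb'', rfl⟩, rfl⟩, _,
    integral_shear_single_mem hxz _, rfl⟩
  simp [h0 l hl, hb'' l (hl.trans hxz.le)]

/-- Every element of `F` lies in `E`, or is the limit for `z → 0` of a one-parameter family that is
contained in `E` for `z ≠ 0`. -/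
def IsGenericallyIn (F E : Set (GL (Fin n) ℂ⸨X⸩)) : Prop :=
  ∀ f ∈ F, f ∈ E ∨ ∃ A B i, ∃ b : Fin n → ℂ, f = A * B ∧
    ∀ z : ℂ, z ≠ 0 → A * integral n (const n (shear i (z • b))) * B ∈ E

theorem isGenericallyIn_yxz {x y z : Fin n} (hxy : x ≤ y) (hyz : y < z) :
    IsGenericallyIn (lowerSteps y * lowerSteps z * lowerSteps x)
      (lowerSteps y * lowerSteps x * lowerSteps z * lowerUnipotents n) := by
  rintro _ ⟨_, ⟨_, ⟨b, hb, rfl⟩, _, ⟨b', hb', rfl⟩, rfl⟩, _, ⟨b'', hb'', rfl⟩, rfl⟩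
  dsimp only
  rcases hxy.eq_or_lt with rfl | hxy
  · exact Or.inl ⟨_, step_mem_yyz hyz hb hb' hb'', 1,
      ⟨1, ⟨fun l => by simp, fun l m h => by simp [h.ne]⟩, map_one _⟩, mul_one _⟩
  by_cases h : b'' y = 0
  -- The family replaces b'' by b'' + c e_y. This is a lower triangular parameter since x < y, and
  -- its y-component is c ≠ 0.
  · refine Or.inr ⟨elementaryStep y b * elementaryStep z b', elementaryStep x b'', x,
      Pi.single y 1, rfl, fun c hc => ?_⟩
    rw [mul_assoc (elementaryStep y b * _), integral_shear_mul_elementaryStep]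
    refine step_mem_yxz hxy hyz hb hb' (fun l hl => ?_) ?_
    · simp [hb'' l hl, (hl.trans_lt hxy).ne]
    · simp [h, hc]
  · exact Or.inl (step_mem_yxz hxy hyz hb hb' hb'' h)

theorem isGenericallyIn_xzy {x y z : Fin n} (hxy : x < y) (hyz : y ≤ z) :
    IsGenericallyIn (lowerSteps z * lowerSteps x * lowerSteps y)
      (lowerSteps x * lowerSteps z * lowerSteps y * lowerUnipotents n) := by
  rintro _ ⟨_, ⟨_, ⟨b, hb, rfl⟩, _, ⟨b', hb', rfl⟩, rfl⟩, _, ⟨b'', hb'', rfl⟩, rfl⟩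
  dsimp only
  rcases hyz.eq_or_lt with rfl | hyz
  · exact Or.inl (step_mem_xzz hxy hb hb' hb'')
  by_cases h : b'' z = 0
  -- The family replaces b'' by b'' + c e_z, whose z-component is c ≠ 0.
  · refine Or.inr ⟨elementaryStep z b * elementaryStep x b', elementaryStep y b'', y,
      Pi.single z 1, rfl, fun c hc => ?_⟩
    rw [mul_assoc (elementaryStep z b * _), integral_shear_mul_elementaryStep]
    refine step_mem_xzy hxy hyz hb hb' (fun l hl => ?_) ?_
    · simp [hb'' l hl, (hl.trans_lt hyz).ne]
    · simp [h, hc]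
  · exact Or.inl (step_mem_xzy hxy hyz hb hb' hb'' h)

theorem image_subset_of_subset {P E F : Set (GL (Fin n) ℂ⸨X⸩)} (w : List (Fin n))
    (h : E ⊆ F * lowerUnipotents n) :
    AffineGrassmannian.ofGL '' (P * E * lowerProducts w) ⊆
      AffineGrassmannian.ofGL '' (P * F * lowerProducts w) := by
  rintro _ ⟨g, hg, rfl⟩
  refine ofGL_image_mul_lowerProducts_subset w ?_
  rw [mul_assoc P]
  exact Set.mul_subset_mul_right (Set.mul_subset_mul_left h) hg

/-- Membership up to limits passes from the middle factor to the whole word: multiplying a family by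
fixed matrices on both sides keeps the shape to which `ofGL_mem_of_shear` applies. -/
theorem image_subset_closure {P E F : Set (GL (Fin n) ℂ⸨X⸩)} (w : List (Fin n))
    (h : IsGenericallyIn F (E * lowerUnipotents n)) :
    AffineGrassmannian.ofGL '' (P * F * lowerProducts w) ⊆
      closure (AffineGrassmannian.ofGL '' (P * E * lowerProducts w)) := by
  rintro _ ⟨_, ⟨_, ⟨p, hp, f, hf, rfl⟩, t, ht, rfl⟩, rfl⟩
  have key : ∀ e ∈ E * lowerUnipotents n, AffineGrassmannian.ofGL (p * e * t) ∈
      closure (AffineGrassmannian.ofGL '' (P * E * lowerProducts w)) := fun e he =>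
    subset_closure (ofGL_image_mul_lowerProducts_subset w (by
      rw [mul_assoc P]
      exact ⟨_, ⟨p, hp, e, he, rfl⟩, t, ht, rfl⟩))
  rcases h f hf with h | ⟨A, B, i, b, rfl, h⟩
  · exact key f h
  · dsimp only
    rw [← mul_assoc, mul_assoc (p * A)]
    refine ofGL_mem_of_shear isClosed_closure (p * A) (B * t) i b fun z hz => ?_
    have := key _ (h z hz)
    simpa only [mul_assoc] using this

/-- In both relations the word in which x directly precedes z has the smaller image, and the image
of the other word lies in its closure. -/
theorem closure_image_lowerProducts_eq {w₁ w₂ : List (Fin n)} (hK : KnuthRelation w₁ w₂) :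
    closure (AffineGrassmannian.ofGL '' lowerProducts w₁) =
      closure (AffineGrassmannian.ofGL '' lowerProducts w₂) := by
  have triple : ∀ i j k : Fin n, lowerProducts [i, j, k] =
      lowerSteps i * lowerSteps j * lowerSteps k := fun i j k => by
    rw [lowerProducts_cons, lowerProducts_cons, lowerProducts_singleton, mul_assoc]
  cases hK with
  | xzy_zxy v₁ v₂ x y z hxy hyz =>
    simp only [lowerProducts_append, triple]
    refine (closure_mono (image_subset_of_subset v₂ ?_)).antisymm
      (closure_minimal (image_subset_closure v₂ (isGenericallyIn_xzy hxy hyz)) isClosed_closure)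
    refine (Set.mul_subset_mul_right (lowerSteps_mul_lowerSteps_subset (hxy.trans_le hyz))).trans ?_
    have := Set.mul_subset_mul_left (s := lowerSteps z * lowerSteps x)
      (lowerUnipotents_mul_lowerSteps y)
    simpa only [mul_assoc] using this
  | yzx_yxz v₁ v₂ x y z hxy hyz =>
    simp only [lowerProducts_append, triple]
    refine (closure_minimal (image_subset_closure v₂ (isGenericallyIn_yxz hxy hyz))
      isClosed_closure).antisymm (closure_mono (image_subset_of_subset v₂ ?_))
    have := Set.mul_subset_mul_left (s := lowerSteps y)
      (lowerSteps_mul_lowerSteps_subset (hxy.trans_lt hyz))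
    simpa only [mul_assoc] using this

end KnuthMV

namespace KnuthMV

open Matrix

variable {n : ℕ}

/-! ### Coordinates on the Bott-Samelson variety -/

theorem det_integral (A : SL(n, ℂ⟦X⟧)) : (integral n A).det = 1 :=
  SpecialLinearGroup.det_mapGL A

/-- Two matrices with the same determinant define the same point of the affine Grassmannian
of `PSL_n` iff they differ by an element of `SL_n(𝒪)`. -/
theorem ofGL_eq_ofGL_iff {g g' : GL (Fin n) ℂ⸨X⸩} (hdet : g.det = g'.det) :
    AffineGrassmannian.ofGL g = AffineGrassmannian.ofGL g' ↔
      ∃ A : SL(n, ℂ⟦X⟧), g' = g * integral n A := by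
  refine ⟨fun h => ?_, fun ⟨A, hA⟩ => by rw [hA, ofGL_mul_integral]⟩
  rcases n.eq_zero_or_pos with rfl | hn
  · exact ⟨1, Units.ext (Matrix.ext fun i => i.elim0)⟩
  obtain ⟨B, hB⟩ := QuotientGroup.eq.1 h
  rw [← map_inv, ← map_mul] at hB
  obtain ⟨u, hu⟩ := ProjGenLinGroup.mk_eq_mk_iff.1 hB
  -- The two matrices differ by an integral matrix B and a scalar u. Equality of determinants says
  -- det B · uⁿ = 1, so uⁿ is integral, and u is integral because 𝒪 is integrally closed. Then uB is
  -- the required element of SL_n(𝒪).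
  have hd : algebraMap ℂ⟦X⟧ ℂ⸨X⸩ B.1.det * u.1 ^ n = 1 := by
    have h1 := congrArg (fun g : GL (Fin n) ℂ⸨X⸩ => g.1.det) hu
    have h2 : (g⁻¹ * g').1.det = 1 := by
      have : (g⁻¹ * g').det = 1 := by rw [map_mul, map_inv, hdet, inv_mul_cancel]
      exact congrArg Units.val this
    rw [h2] at h1
    rw [← h1, Units.val_mul, det_mul]
    congr 1
    · rw [RingHom.map_det]; rfl
    · simp
  have hu' : IsIntegral ℂ⟦X⟧ (u.1 ^ n) := by
    have hBu : IsUnit B.1.det := (Matrix.isUnit_iff_isUnit_det _).1 (Units.isUnit _)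
    obtain ⟨d, hd'⟩ := hBu
    have : u.1 ^ n = algebraMap ℂ⟦X⟧ ℂ⸨X⸩ d⁻¹.1 := by
      calc u.1 ^ n = algebraMap ℂ⟦X⟧ ℂ⸨X⸩ (d⁻¹.1 * d.1) * u.1 ^ n := by
            rw [Units.inv_mul, map_one, one_mul]
        _ = _ := by rw [map_mul, mul_assoc, hd', hd, mul_one]
    rw [this]
    exact isIntegral_algebraMap
  obtain ⟨y, hy⟩ := IsIntegrallyClosed.exists_algebraMap_eq_of_isIntegral_pow hn hu'
  refine ⟨⟨y • B.1, ?_⟩, ?_⟩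
  · refine IsFractionRing.injective ℂ⟦X⟧ ℂ⸨X⸩ ?_
    rw [det_smul, Fintype.card_fin, map_mul, map_pow, hy, map_one, mul_comm, hd]
  · rw [eq_comm, ← eq_inv_mul_iff_mul_eq, ← hu]
    refine Units.ext (Matrix.ext fun i j => ?_)
    change algebraMap ℂ⟦X⟧ ℂ⸨X⸩ (y * B.1 i j) =
      ((B.1.map (algebraMap ℂ⟦X⟧ ℂ⸨X⸩)) * Matrix.scalar (Fin n) u.1) i j
    rw [map_mul, hy, Matrix.scalar_apply, Matrix.mul_diagonal, mul_comm]
    rfl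

/-- The element `t^{-μ} B t^μ` of the parahoric subgroup of `μ`. -/
noncomputable def parahoricConj (μ : Fin n → ℤ) (B : SL(n, ℂ⟦X⟧)) : SL(n, ℂ⸨X⸩) :=
  ⟨(tPow (-μ) * integral n B * (tPow (-μ))⁻¹).1, by
    have : (tPow (-μ) * integral n B * (tPow (-μ))⁻¹).det = 1 := by
      rw [map_mul, map_mul, map_inv, det_integral, mul_one, mul_inv_cancel]
    exact congrArg Units.val this⟩

theorem toGL_parahoricConj (μ : Fin n → ℤ) (B : SL(n, ℂ⟦X⟧)) :
    SpecialLinearGroup.toGL (parahoricConj μ B) = tPow (-μ) * integral n B * (tPow (-μ))⁻¹ :=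
  Units.ext rfl

theorem parahoricConj_mem (μ : Fin n → ℤ) (B : SL(n, ℂ⟦X⟧)) : parahoricConj μ B ∈ parahoric μ :=
  (parahoric_aux μ _).2 ⟨B, toGL_parahoricConj μ B⟩

theorem exists_eq_parahoricConj {μ : Fin n → ℤ} {A : SL(n, ℂ⸨X⸩)} (hA : A ∈ parahoric μ) :
    ∃ B, A = parahoricConj μ B := by
  obtain ⟨B, hB⟩ := (parahoric_aux μ A).1 hA
  exact ⟨B, SpecialLinearGroup.toGL_injective (hB.trans (toGL_parahoricConj μ B).symm)⟩

theorem coeff_parahoricConj (μ : Fin n → ℤ) (B : SL(n, ℂ⟦X⟧)) (l m : Fin n) (k : ℤ) :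
    ((parahoricConj μ B).1 l m).coeff k =
      if k + μ l - μ m < 0 then 0 else PowerSeries.coeff (k + μ l - μ m).natAbs (B.1 l m) := by
  have : (parahoricConj μ B).1 l m = HahnSeries.single (-μ l) 1 *
      HahnSeries.ofPowerSeries ℤ ℂ (B.1 l m) * HahnSeries.single (μ m) 1 := by
    change ((Matrix.diagonal (fun i => HahnSeries.single ((-μ) i) (1 : ℂ)) * (integral n B).1) *
        Matrix.diagonal (fun i => HahnSeries.single (-(-μ) i) (1 : ℂ))) l m = _
    rw [Matrix.mul_diagonal, Matrix.diagonal_mul, integral_apply]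
    simp
  rw [this, HahnSeries.coeff_mul_single, HahnSeries.coeff_single_mul, PowerSeries.coeff_coe]
  have e : k - μ m - -μ l = k + μ l - μ m := by ring
  rw [e]
  simp

/-- The matrices `p_0 ⋯ p_{j-1} t^{-μ_j}`, for `p_j = t^{-μ_j} P_j t^{μ_j}`. -/
noncomputable def frame (c : List (Fin n)) (P : ℕ → SL(n, ℂ⟦X⟧)) : ℕ → GL (Fin n) ℂ⸨X⸩
  | 0 => 1
  | j + 1 => frame c P j * integral n (P j) * tPow (vertex c j - vertex c (j + 1))

/-- Needed to apply `ofGL_eq_ofGL_iff`, which compares matrices of equal determinant. -/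
theorem det_frame (c : List (Fin n)) (P P' : ℕ → SL(n, ℂ⟦X⟧)) (j : ℕ) :
    (frame c P j).det = (frame c P' j).det := by
  induction j with
  | zero => rfl
  | succ j ih => simp only [frame, map_mul, ih, det_integral]

/-- The tuple `(p_0, …, p_N)` with `p_j = t^{-μ_j} P_j t^{μ_j}`. -/
noncomputable def ParahoricProduct.ofIntegral (c : List (Fin n)) (P : ℕ → SL(n, ℂ⟦X⟧)) :
    ParahoricProduct c :=
  ⟨fun j => parahoricConj (vertex c j) (P j), fun _ => parahoricConj_mem _ _⟩

theorem ParahoricProduct.exists_eq_ofIntegral {c : List (Fin n)} (p : ParahoricProduct c) :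
    ∃ P, p = ofIntegral c P := by
  choose B hB using fun j => exists_eq_parahoricConj (p.2 j)
  refine ⟨fun j => if h : j < c.length + 1 then B ⟨j, h⟩ else 1, ?_⟩
  obtain ⟨p, hp⟩ := p
  rw [ofIntegral, ParahoricProduct.mk.injEq]
  funext j
  rw [dif_pos j.2]
  exact hB j

theorem vertex_zero (c : List (Fin n)) : vertex c 0 = 0 := by
  funext i; simp [vertex]

theorem toGL_partialProd (c : List (Fin n)) (P : ℕ → SL(n, ℂ⟦X⟧)) (j : Fin (c.length + 1)) :
    SpecialLinearGroup.toGL (Fin.partialProd (fun i : Fin c.length =>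
      (ParahoricProduct.ofIntegral c P).1 i.castSucc) j) * tPow (-vertex c j) = frame c P j := by
  obtain ⟨j, hj⟩ := j
  induction j with
  | zero =>
    change SpecialLinearGroup.toGL (Fin.partialProd _ 0) * tPow (-vertex c 0) = 1
    rw [Fin.partialProd_zero, vertex_zero, neg_zero, tPow_zero, map_one, mul_one]
  | succ j ih =>
    have hj' : j < c.length := by omega
    have e : (⟨j + 1, hj⟩ : Fin (c.length + 1)) = Fin.succ ⟨j, hj'⟩ := rfl
    rw [e, Fin.partialProd_succ, map_mul]
    change _ * SpecialLinearGroup.toGL (parahoricConj (vertex c j) (P j)) *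
      tPow (-vertex c (j + 1)) = frame c P j * integral n (P j) * tPow (vertex c j - vertex c (j + 1))
    rw [toGL_parahoricConj, ← ih (by omega), sub_eq_add_neg, tPow_add, tPow_neg (vertex c j),
      inv_inv]
    simp only [mul_assoc]
    rfl

theorem smul_ofGL (A : SL(n, ℂ⸨X⸩)) (g : GL (Fin n) ℂ⸨X⸩) :
    SpecialLinearGroup.toPGL A • AffineGrassmannian.ofGL g =
      AffineGrassmannian.ofGL (SpecialLinearGroup.toGL A * g) := rfl

namespace BottSamelson

/-- The point `[p_0, …, p_N]` with `p_j = t^{-μ_j} P_j t^{μ_j}`. -/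
noncomputable def mk (c : List (Fin n)) (P : ℕ → SL(n, ℂ⟦X⟧)) : BottSamelson c :=
  Quotient.mk (bottSamelsonSetoid c) (ParahoricProduct.ofIntegral c P)

theorem exists_eq_mk {c : List (Fin n)} (x : BottSamelson c) : ∃ P, x = mk c P := by
  induction x using Quotient.ind with | _ p =>
  obtain ⟨P, rfl⟩ := p.exists_eq_ofIntegral
  exact ⟨P, rfl⟩

theorem point_mk (c : List (Fin n)) (P : ℕ → SL(n, ℂ⟦X⟧)) (j : Fin (c.length + 1)) :
    (mk c P).point j = AffineGrassmannian.ofGL (frame c P j) := by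
  rw [← toGL_partialProd]
  rfl

/-- The matrices A_j, conjugated by t^{-μ_j}, give elements a_j ∈ 𝒫_{μ_j} with a_j p'_j = p_j
a_{j+1}. These relations are those of the orbit equivalence. -/
theorem mk_eq_mk_of_frame {c : List (Fin n)} {P P' : ℕ → SL(n, ℂ⟦X⟧)}
    (h : ∀ j ≤ c.length, ∃ A : SL(n, ℂ⟦X⟧), frame c P' j = frame c P j * integral n A) :
    mk c P = mk c P' := by
  choose! A hA using h
  have key : ∀ j < c.length, parahoricConj (vertex c j) (A j) * parahoricConj (vertex c j) (P' j) =
      parahoricConj (vertex c j) (P j) * parahoricConj (vertex c (j + 1)) (A (j + 1)) := by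
    intro j hj
    refine SpecialLinearGroup.toGL_injective ?_
    have h1 := hA (j + 1) hj
    rw [frame, frame, hA j hj.le] at h1
    simp only [mul_assoc, mul_right_inj] at h1
    rw [sub_eq_add_neg, tPow_add] at h1
    simp only [map_mul, toGL_parahoricConj]
    rw [tPow_neg] at h1
    simp only [tPow_neg, inv_inv, mul_assoc, mul_right_inj, mul_inv_cancel_left]
    have h2 := congrArg (· * tPow (vertex c (j + 1))) h1
    simpa only [mul_assoc, inv_mul_cancel, mul_one] using h2
  have h0 : parahoricConj (vertex c 0) (A 0) = 1 := by
    refine SpecialLinearGroup.toGL_injective ?_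
    have h1 := hA 0 (Nat.zero_le _)
    rw [frame, frame, one_mul] at h1
    rw [toGL_parahoricConj, ← h1, mul_one, mul_inv_cancel, map_one]
  -- The choice q_j = p_j⁻¹ a_j p'_j visibly lies in 𝒫_{μ_j}; for j < N it equals a_{j+1}, hence
  -- lies in 𝒫_{μ_{j+1}} too. At j = N there is no a_{N+1}, and the first description suffices.
  refine Quotient.sound (s := bottSamelsonSetoid c)
    ⟨fun j => (parahoricConj (vertex c j) (P j))⁻¹ * parahoricConj (vertex c j) (A j) *
      parahoricConj (vertex c j) (P' j), fun j => ⟨?_, ?_⟩, ?_, ?_, fun j => ?_⟩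
  · change _ ∈ parahoric (vertex c j)
    exact mul_mem (mul_mem (inv_mem (parahoricConj_mem _ _)) (parahoricConj_mem _ _))
      (parahoricConj_mem _ _)
  · change _ * parahoricConj (vertex c j) (A j) * parahoricConj (vertex c j) (P' j) ∈ _
    rw [mul_assoc, key j j.2, Fin.val_castSucc, inv_mul_cancel_left]
    exact parahoricConj_mem _ _
  · exact mul_mem (mul_mem (inv_mem (parahoricConj_mem _ _)) (parahoricConj_mem _ _))
      (parahoricConj_mem _ _)
  · change parahoricConj (vertex c 0) (P' 0) = parahoricConj (vertex c 0) (P 0) *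
      ((parahoricConj (vertex c 0) (P 0))⁻¹ * parahoricConj (vertex c 0) (A 0) *
        parahoricConj (vertex c 0) (P' 0))
    rw [h0]
    group
  · change parahoricConj (vertex c (j + 1)) (P' (j + 1)) =
      ((parahoricConj (vertex c j) (P j))⁻¹ * parahoricConj (vertex c j) (A j) *
        parahoricConj (vertex c j) (P' j))⁻¹ * parahoricConj (vertex c (j + 1)) (P (j + 1)) *
      ((parahoricConj (vertex c (j + 1)) (P (j + 1)))⁻¹ *
        parahoricConj (vertex c (j + 1)) (A (j + 1)) * parahoricConj (vertex c (j + 1)) (P' (j + 1)))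
    rw [mul_assoc _ (parahoricConj (vertex c j) (A j)), key j j.2]
    group

theorem mk_eq_mk_iff {c : List (Fin n)} {P P' : ℕ → SL(n, ℂ⟦X⟧)} :
    mk c P = mk c P' ↔
      ∀ j ≤ c.length, ∃ A : SL(n, ℂ⟦X⟧), frame c P' j = frame c P j * integral n A := by
  refine ⟨fun h j hj => ?_, mk_eq_mk_of_frame⟩
  rw [← ofGL_eq_ofGL_iff (det_frame c P P' j)]
  have := congrArg (point ⟨j, Nat.lt_succ_of_le hj⟩) h
  rwa [point_mk, point_mk] at this

theorem point_translate {c : List (Fin n)} (g : parahoric (vertex c 0)) (x : BottSamelson c)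
    (j : Fin (c.length + 1)) :
    (translate g x).point j = SpecialLinearGroup.toPGL g.1 • x.point j := by
  induction x using Quotient.ind with | _ p =>
  cases j using Fin.cases with
  | zero =>
    have h := parahoric_smul _ g.2
    change SpecialLinearGroup.toPGL (Fin.partialProd _ 0) • coweightPoint (vertex c 0) =
      SpecialLinearGroup.toPGL g.1 • SpecialLinearGroup.toPGL (Fin.partialProd _ 0) •
        coweightPoint (vertex c 0)
    rw [Fin.partialProd_zero, Fin.partialProd_zero, map_one, one_smul, h]
  | succ j =>
    have key : Fin.partialProd (fun i : Fin c.length =>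
        Function.update p.1 0 (g.1 * p.1 0) i.castSucc) j.succ =
          g.1 * Fin.partialProd (fun i : Fin c.length => p.1 i.castSucc) j.succ := by
      obtain ⟨j, hj⟩ := j
      induction j with
      | zero =>
        rw [Fin.partialProd_succ, Fin.partialProd_succ]
        have e : Fin.castSucc (⟨0, hj⟩ : Fin c.length) = 0 := rfl
        simp [e]
      | succ j ih =>
        have ih := ih (by omega)
        rw [Fin.partialProd_succ, Fin.partialProd_succ]
        have e : Fin.castSucc (⟨j + 1, hj⟩ : Fin c.length) =
          Fin.succ (⟨j, by omega⟩ : Fin c.length) := rfl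
        rw [e, ih, Function.update_of_ne (Fin.succ_ne_zero _), mul_assoc]
    change SpecialLinearGroup.toPGL (Fin.partialProd (fun i : Fin c.length =>
        Function.update p.1 0 (g.1 * p.1 0) i.castSucc) j.succ) • coweightPoint (vertex c j.succ) =
      SpecialLinearGroup.toPGL g.1 • SpecialLinearGroup.toPGL (Fin.partialProd (fun i : Fin c.length =>
        p.1 i.castSucc) j.succ) • coweightPoint (vertex c j.succ)
    rw [key, map_mul, mul_smul]

end BottSamelson

end KnuthMV

namespace KnuthMV

open Matrix
open scoped PowerSeries.WithPiTopology

variable {n : ℕ}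

/-! ### The classical topology of the Bott-Samelson variety -/

theorem continuous_specialLinearGroup_iff {α : Type*} [TopologicalSpace α] {f : α → SL(n, ℂ⟦X⟧)} :
    Continuous f ↔ ∀ l m d, Continuous fun x => PowerSeries.coeff d ((f x).1 l m) := by
  refine ⟨fun h l m d => (PowerSeries.WithPiTopology.continuous_coeff ℂ d).comp
    ((continuous_subtype_val.comp h).matrix_elem l m), fun h => ?_⟩
  refine Continuous.subtype_mk (f := fun x => (f x).1) (continuous_matrix fun l m => ?_) _
  rw [continuous_iff_continuousAt]
  intro x
  refine (PowerSeries.WithPiTopology.tendsto_iff_coeff_tendsto ℂ _ _ _).2 fun d => ?_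
  exact (h l m d).continuousAt

theorem ParahoricProduct.continuous_ofIntegral (c : List (Fin n)) :
    Continuous (ofIntegral c) := by
  refine continuous_induced_rng.2 (continuous_pi fun v => ?_)
  change Continuous fun P : ℕ → SL(n, ℂ⟦X⟧) =>
    ((parahoricConj (vertex c v.1) (P v.1)).1 v.2.1 v.2.2.1).coeff v.2.2.2
  simp only [coeff_parahoricConj]
  split_ifs
  · exact continuous_const
  · exact continuous_specialLinearGroup_iff.1 (continuous_apply (v.1 : ℕ)) _ _ _

/-- The integral matrices are recovered from the p_j by shifting the indices of Laurent
coefficients, which is continuous. -/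
theorem ParahoricProduct.exists_continuous_rightInverse (c : List (Fin n)) :
    ∃ ψ : ParahoricProduct c → ℕ → SL(n, ℂ⟦X⟧), Continuous ψ ∧
      Function.RightInverse ψ (ofIntegral c) := by
  choose B hB using fun (p : ParahoricProduct c) j => exists_eq_parahoricConj (p.2 j)
  refine ⟨fun p j => if h : j < c.length + 1 then B p ⟨j, h⟩ else 1, ?_, fun p => ?_⟩
  · refine continuous_pi fun j => ?_
    by_cases h : j < c.length + 1
    · simp only [dif_pos h]
      refine continuous_specialLinearGroup_iff.2 fun l m d => ?_
      have e : ∀ p, PowerSeries.coeff d ((B p ⟨j, h⟩).1 l m) =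
          ((p.1 ⟨j, h⟩).1 l m).coeff (d - vertex c j l + vertex c j m) := fun p => by
        rw [hB p ⟨j, h⟩, coeff_parahoricConj]
        have e : (d - vertex c j l + vertex c j m + vertex c j l - vertex c j m : ℤ) = d := by ring
        rw [e, if_neg (by omega), Int.natAbs_natCast]
      simp only [e]
      have hc : Continuous (fun (p : ParahoricProduct c)
          (v : Fin (c.length + 1) × Fin n × Fin n × ℤ) =>
            ((p.1 v.1).1 v.2.1 v.2.2.1).coeff v.2.2.2) := continuous_induced_dom
      exact continuous_pi_iff.1 hc (⟨j, h⟩, l, m, d - vertex c j l + vertex c j m)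
    · simp only [dif_neg h]
      exact continuous_const
  · obtain ⟨p, hp⟩ := p
    rw [ofIntegral, ParahoricProduct.mk.injEq]
    funext j
    simp only [dif_pos j.2]
    exact (hB ⟨p, hp⟩ j).symm

namespace BottSamelson

theorem continuous_mk (c : List (Fin n)) : Continuous (mk c) :=
  continuous_quotient_mk'.comp (ParahoricProduct.continuous_ofIntegral c)

/-- The parametrization is open, as for a quotient by a group action: representatives of nearby
points can be moved near any prescribed representative. -/
theorem image_mk_mem_nhds {c : List (Fin n)} {P : ℕ → SL(n, ℂ⟦X⟧)}
    {V : Set (ℕ → SL(n, ℂ⟦X⟧))} (hV : V ∈ 𝓝 P) : mk c '' V ∈ 𝓝 (mk c P) := by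
  obtain ⟨ψ, hψ, hψ'⟩ := ParahoricProduct.exists_continuous_rightInverse c
  obtain ⟨U, hUV, hU, hPU⟩ := mem_nhds_iff.1 hV
  refine Filter.mem_of_superset (IsOpen.mem_nhds ?_ (Set.mem_image_of_mem _ hPU))
    (Set.image_mono hUV)
  change IsOpen (Quotient.mk (bottSamelsonSetoid c) ⁻¹' (mk c '' U))
  rw [isOpen_iff_mem_nhds]
  rintro p ⟨P', hP', hp⟩
  have hmk : ∀ p, Quotient.mk (bottSamelsonSetoid c) p = mk c (ψ p) := fun p => by
    rw [mk, hψ' p]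
  rw [hmk] at hp
  choose! A hA using mk_eq_mk_iff.1 hp
  -- The same change of frames by the fixed matrices A_j that carries ψ p to P' is applied to every
  -- ψ q. Thus Q q represents the same point as q, depends continuously on q, and equals P' at q =
  -- p.
  let Q : ParahoricProduct c → ℕ → SL(n, ℂ⟦X⟧) := fun q j =>
    A j * ψ q j * ((ψ p j)⁻¹ * (A j)⁻¹ * P' j)
  have hQ : Continuous Q := by
    refine continuous_pi fun j => ?_
    exact (continuous_const.mul ((continuous_apply j).comp hψ)).mul continuous_const
  have hQp : Q p = P' := by
    funext j
    simp only [Q]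
    group
  have hframe : ∀ q, ∀ j ≤ c.length, frame c (ψ q) j = frame c (Q q) j * integral n (A j) := by
    intro q j
    induction j with
    | zero => exact fun h => hA 0 h
    | succ j ih =>
      intro hj
      have h1 := hA (j + 1) hj
      rw [frame, frame, hA j (by omega)] at h1
      simp only [mul_assoc, mul_right_inj] at h1
      rw [frame, frame, ih (by omega)]
      simp only [Q, map_mul, map_inv, mul_assoc, mul_right_inj]
      rw [← h1, inv_mul_cancel_left, inv_mul_cancel_left]
  filter_upwards [hQ.continuousAt.preimage_mem_nhds (by rw [hQp]; exact hU.mem_nhds hP')] with q hq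
  exact ⟨Q q, hq, (mk_eq_mk_of_frame fun j hj => ⟨A j, hframe q j hj⟩).trans (hmk q).symm⟩

end BottSamelson

end KnuthMV

namespace KnuthMV

open Matrix

variable {n : ℕ}

/-! ### Charts of the Bott-Samelson variety around the torus fixed points -/

theorem vertex_succ {u : List (Fin n)} {j : ℕ} (h : j < u.length) :
    vertex u (j + 1) = vertex u j + Pi.single u[j] 1 := by
  funext i
  simp only [vertex, List.take_succ_eq_append_getElem h, List.count_append, Pi.add_apply]
  by_cases hi : i = u[j]
  · subst hi; simp
  · simp [List.count_eq_zero, hi]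

theorem vertex_sub_vertex_succ {u : List (Fin n)} {j : ℕ} (h : j < u.length) :
    vertex u j - vertex u (j + 1) = -Pi.single u[j] 1 := by
  rw [vertex_succ h, sub_add_cancel_left]

/-- Needed because the letters of the center and of w differ: conjugation by such a matrix turns the
t^{-ε_m} of the center into the t^{-ε_i} of w. -/
theorem exists_weyl (i m : Fin n) : ∃ k : SL(n, ℂ),
    (∀ l, k.1 l m = (Pi.single i 1 : Fin n → ℂ) l) ∧
      tPow (-Pi.single i 1) * integral n (const n k) =
        integral n (const n k) * tPow (-Pi.single m 1) := by
  by_cases him : i = m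
  · subst him
    refine ⟨1, fun l => ?_, by simp⟩
    by_cases hl : l = i
    · subst hl; simp
    · simp [hl]
  have him' : m ≠ i := Ne.symm him
  have h1 : (Pi.single i 1 : Fin n → ℂ) m = 0 := Pi.single_eq_of_ne him' _
  have h2 : (-Pi.single m 1 : Fin n → ℂ) i = 0 := by simp [him]
  -- The usual expression of the Weyl element of SL_2 as a product of three root subgroup elements.
  refine ⟨shear m (Pi.single i 1) * shear i (-Pi.single m 1) * shear m (Pi.single i 1),
    fun l => ?_, ext_of_mulVec fun v l => ?_⟩
  · have e := congrFun (mulVec_single_one (shear m (Pi.single i 1) * shear i (-Pi.single m 1) *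
      shear m (Pi.single i 1) : SL(n, ℂ)).1 m) l
    rw [col_apply] at e
    rw [← e]
    change (((shear m (Pi.single i 1)).1 * (shear i (-Pi.single m 1)).1 *
      (shear m (Pi.single i 1)).1) *ᵥ _) l = _
    rw [← mulVec_mulVec, ← mulVec_mulVec]
    have e1 : Function.update (Pi.single i 1 : Fin n → ℂ) m 0 = Pi.single i 1 := by
      rw [Function.update_eq_self_iff, h1]
    have e2 : Function.update (-Pi.single m 1 : Fin n → ℂ) i 0 = -Pi.single m 1 := by
      rw [Function.update_eq_self_iff, h2]
    simp only [shear_mulVec, e1, e2]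
    by_cases hl : l = i
    · subst hl; simp [him, him']
    · by_cases hl' : l = m
      · subst hl'; simp [him, him']
      · simp [hl, him, him']
  · simp only [Units.val_mul, map_mul, ← mulVec_mulVec, tPow_mulVec,
      integral_const_shear_mulVec m h1, integral_const_shear_mulVec i h2]
    by_cases hl : l = i
    · subst hl; simp [him, him', -HahnSeries.C_apply]; ring
    · by_cases hl' : l = m
      · subst hl'; simp [him, him', -HahnSeries.C_apply]; ring
      · simp [hl, hl', him, him', -HahnSeries.C_apply]

/-- A representative in `SL_n(ℂ)` of the transposition of `i` and `m`. -/
noncomputable def weyl (i m : Fin n) : SL(n, ℂ) := (exists_weyl i m).choose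

theorem weyl_apply (i m l : Fin n) : (weyl i m).1 l m = (Pi.single i 1 : Fin n → ℂ) l :=
  (exists_weyl i m).choose_spec.1 l

theorem tPow_mul_weyl (i m : Fin n) : tPow (-Pi.single i 1) * integral n (const n (weyl i m)) =
    integral n (const n (weyl i m)) * tPow (-Pi.single m 1) :=
  (exists_weyl i m).choose_spec.2

/-- The product of the first `j` elementary steps with types the letters of `w` and
parameters `b`. -/
noncomputable def stepProduct (w : List (Fin n)) (b : ℕ → Fin n → ℂ) : ℕ → GL (Fin n) ℂ⸨X⸩
  | 0 => 1
  | j + 1 => stepProduct w b j * if h : j < w.length then elementaryStep w[j] (b j) else 1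

theorem stepProduct_succ {w : List (Fin n)} (b : ℕ → Fin n → ℂ) {j : ℕ} (h : j < w.length) :
    stepProduct w b (j + 1) = stepProduct w b j * elementaryStep w[j] (b j) := by
  rw [stepProduct, dif_pos h]

theorem elementaryStep_congr {i : Fin n} {b b' : Fin n → ℂ} (h : ∀ l, l ≠ i → b l = b' l) :
    elementaryStep i b = elementaryStep i b' := by
  have e : Function.update b i 0 = Function.update b' i 0 := by
    funext l
    by_cases hl : l = i
    · subst hl; simp
    · simp [hl, h l hl]
  have : shear i b = shear i b' := Subtype.ext (by simp only [shear, e])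
  rw [elementaryStep, elementaryStep, this]

theorem stepProduct_congr {w : List (Fin n)} {b b' : ℕ → Fin n → ℂ} {j : ℕ}
    (h : ∀ k < j, b k = b' k) : stepProduct w b j = stepProduct w b' j := by
  induction j with
  | zero => rfl
  | succ j ih => rw [stepProduct, stepProduct, ih fun k hk => h k (by omega), h j (by omega)]

theorem det_stepProduct (w : List (Fin n)) (b b' : ℕ → Fin n → ℂ) (j : ℕ) :
    (stepProduct w b j).det = (stepProduct w b' j).det := by
  induction j with
  | zero => rfl
  | succ j ih =>
    rw [stepProduct, stepProduct, map_mul, map_mul, ih]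
    split_ifs
    · simp only [elementaryStep, map_mul, det_integral]
    · rfl

theorem stepProduct_zero (w : List (Fin n)) {j : ℕ} (hj : j ≤ w.length) :
    stepProduct w 0 j = tPow (-vertex w j) := by
  induction j with
  | zero => rw [stepProduct, vertex_zero, neg_zero, tPow_zero]
  | succ j ih =>
    rw [stepProduct_succ _ hj, ih (by omega), vertex_succ hj, neg_add, tPow_add, elementaryStep,
      Pi.zero_apply, shear_zero, map_one, map_one, one_mul]

theorem stepProduct_append {v w : List (Fin n)} (b : ℕ → Fin n → ℂ) {j : ℕ} (hj : j ≤ v.length) :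
    stepProduct (v ++ w) b j = stepProduct v b j := by
  induction j with
  | zero => rfl
  | succ j ih =>
    rw [stepProduct_succ _ hj, stepProduct_succ _ (by simp; omega), ih (by omega),
      List.getElem_append_left hj]

theorem mem_lowerProducts_iff {w : List (Fin n)} {g : GL (Fin n) ℂ⸨X⸩} :
    g ∈ lowerProducts w ↔ ∃ b : ℕ → Fin n → ℂ,
      (∀ j, ∀ h : j < w.length, ∀ l ≤ w[j], b j l = 0) ∧ g = stepProduct w b w.length := by
  induction w using List.reverseRecOn generalizing g with
  | nil => simp [lowerProducts, stepProduct]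
  | append_singleton v i ih =>
    have hlen : v.length < (v ++ [i]).length := by simp
    have hi : (v ++ [i])[v.length] = i := by simp
    rw [lowerProducts_append, lowerProducts_singleton, Set.mem_mul]
    constructor
    · rintro ⟨g, hg, _, ⟨b', hb', rfl⟩, rfl⟩
      obtain ⟨b, hb, rfl⟩ := ih.1 hg
      refine ⟨Function.update b v.length b', fun j hj l hl => ?_, ?_⟩
      · rcases (Nat.lt_succ_iff_lt_or_eq.1 (by simpa using hj) : j < v.length ∨ j = v.length)
          with h | rfl
        · rw [List.getElem_append_left h] at hl
          rw [Function.update_of_ne h.ne]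
          exact hb j h l hl
        · rw [Function.update_self]
          exact hb' l (by simpa using hl)
      · have e : stepProduct v (Function.update b v.length b') v.length =
            stepProduct v b v.length :=
          stepProduct_congr fun k hk => Function.update_of_ne hk.ne _ _
        rw [List.length_append, List.length_singleton, stepProduct_succ _ hlen,
          stepProduct_append _ le_rfl, Function.update_self, hi, e]
    · rintro ⟨b, hb, rfl⟩
      refine ⟨stepProduct v b v.length, ih.2 ⟨b, fun j hj l hl => ?_, rfl⟩,
        elementaryStep i (b v.length), ⟨b v.length, fun l hl => ?_, rfl⟩, ?_⟩
      · exact hb j (hj.trans hlen) l (by rwa [List.getElem_append_left hj])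
      · exact hb _ hlen l (by rwa [hi])
      · rw [List.length_append, List.length_singleton, stepProduct_succ _ hlen,
          stepProduct_append _ le_rfl, hi]

/-- If two steps of the same type differ on the right by an integral matrix, then the quotient of
their shears fixes the line of e_i modulo t, which forces equal parameters. -/
theorem stepProduct_unique {w : List (Fin n)} {b b' : ℕ → Fin n → ℂ}
    (h : ∀ j ≤ w.length, ∃ A : SL(n, ℂ⟦X⟧), stepProduct w b' j = stepProduct w b j * integral n A)
    {j : ℕ} (hj : j < w.length) {l : Fin n} (hl : l ≠ w[j]) : b' j l = b j l := by
  -- The induction carries honest equality of the partial products, so that they cancel at the next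
  -- step.
  suffices H : ∀ j ≤ w.length, stepProduct w b' j = stepProduct w b j ∧
      ∀ k < j, ∀ hk : k < w.length, ∀ l, l ≠ w[k] → b' k l = b k l from
    (H (j + 1) hj).2 j (Nat.lt_succ_self j) hj l hl
  intro j
  induction j with
  | zero => exact fun _ => ⟨rfl, fun k hk => absurd hk (Nat.not_lt_zero k)⟩
  | succ j ih =>
    intro hj
    obtain ⟨ih1, ih2⟩ := ih (by omega)
    obtain ⟨A, hA⟩ := h (j + 1) hj
    rw [stepProduct_succ _ hj, stepProduct_succ _ hj, ih1, mul_assoc, mul_right_inj,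
      elementaryStep, elementaryStep, mul_assoc, ← inv_mul_eq_iff_eq_mul, ← map_inv, ← map_inv,
      shear_inv, ← mul_assoc, ← map_mul, ← map_mul, shear_mul] at hA
    have hb : ∀ l, l ≠ w[j] → b' j l = b j l := fun l hl => by
      have := constantCoeff_eq_zero_of_conj hA hl
      rw [const_apply, shear_apply_self _ _ hl, PowerSeries.constantCoeff_C, Pi.add_apply,
        Pi.neg_apply, neg_add_eq_zero] at this
      exact this.symm
    refine ⟨?_, fun k hk hkw l hl => ?_⟩
    · rw [stepProduct_succ _ hj, stepProduct_succ _ hj, ih1, elementaryStep_congr hb]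
    · rcases Nat.lt_succ_iff_lt_or_eq.1 hk with hk | rfl
      · exact ih2 k hk hkw l hl
      · exact hb l hl

/-- The permutation matrices that carry the letters of `u` to the letters of `w`. -/
noncomputable def weylAt (w u : List (Fin n)) : ℕ → SL(n, ℂ)
  | 0 => 1
  | j + 1 => if h : j < w.length ∧ j < u.length then weyl (w[j]'h.1) (u[j]'h.2) else 1

theorem weylAt_succ {w u : List (Fin n)} {j : ℕ} (hw : j < w.length) (hc : j < u.length) :
    weylAt w u (j + 1) = weyl w[j] u[j] := by
  rw [weylAt, dif_pos ⟨hw, hc⟩]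

/-- The coordinates of the point of the Bott-Samelson variety with center `u` in the chart around
the fixed point of `w` that has the parameters `b`. -/
noncomputable def chart (w u : List (Fin n)) (b : ℕ → Fin n → ℂ) (j : ℕ) : SL(n, ℂ⟦X⟧) :=
  if h : j < w.length then
    const n ((weylAt w u j)⁻¹ * shear w[j] (b j) * weylAt w u (j + 1)) else 1

/-- The permutation matrices in consecutive factors of `chart` telescope. -/
theorem frame_chart {w u : List (Fin n)} (hc : u.length = w.length) (b : ℕ → Fin n → ℂ) {j : ℕ}
    (hj : j ≤ w.length) :
    frame u (chart w u b) j = stepProduct w b j * integral n (const n (weylAt w u j)) := by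
  induction j with
  | zero => simp [frame, stepProduct, weylAt]
  | succ j ih =>
    rw [frame, ih (by omega), vertex_sub_vertex_succ (by omega), chart,
      dif_pos (show j < w.length from hj),
      stepProduct_succ _ hj, weylAt_succ hj (by omega), map_mul, map_mul, map_mul, map_mul,
      mul_assoc, mul_assoc, mul_assoc, ← tPow_mul_weyl, elementaryStep]
    simp only [map_inv, mul_assoc, mul_inv_cancel_left]

/-! ### The one-parameter subgroup -/

/-- The diagonal matrix `diag(s^{a 1}, …, s^{a n})` in `SL_n(ℂ)`. -/
def torus (a : Fin n → ℤ) (ha : ∑ i, a i = 0) (s : ℂˣ) : SL(n, ℂ) :=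
  ⟨Matrix.diagonal fun i => ((s ^ a i : ℂˣ) : ℂ), by
    have h := det_oneParameter a ha s
    rw [det_diagonal, ← map_prod] at h
    rw [det_diagonal]
    exact HahnSeries.C_injective (h.trans (map_one _).symm)⟩

theorem toGL_oneParameter (a : Fin n → ℤ) (ha : ∑ i, a i = 0) (c : List (Fin n)) (s : ℂˣ) :
    SpecialLinearGroup.toGL (oneParameter a ha c s).1 = integral n (const n (torus a ha s)) := by
  refine Units.ext (Matrix.ext fun l m => ?_)
  rw [integral_apply, const_apply, HahnSeries.ofPowerSeries_C]
  change (Matrix.diagonal fun i => HahnSeries.C ((s ^ a i : ℂˣ) : ℂ)) l m =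
    HahnSeries.C ((Matrix.diagonal fun i => ((s ^ a i : ℂˣ) : ℂ)) l m)
  by_cases h : l = m
  · subst h; simp
  · simp [h]

theorem torus_mul_elementaryStep (a : Fin n → ℤ) (ha : ∑ i, a i = 0) (s : ℂˣ) {i : Fin n}
    {b : Fin n → ℂ} (hb : b i = 0) :
    integral n (const n (torus a ha s)) * elementaryStep i b =
      elementaryStep i (fun l => ((s ^ (a l - a i) : ℂˣ) : ℂ) * b l) *
        integral n (const n (torus a ha s)) := by
  have hT : ∀ v l, ((integral n (const n (torus a ha s))).1 *ᵥ v) l =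
      HahnSeries.C ((s ^ a l : ℂˣ) : ℂ) * v l := fun v l => by
    -- The matrix does not depend on the center, so the empty word serves.
    rw [← toGL_oneParameter a ha []]
    change ((Matrix.diagonal fun i => HahnSeries.C ((s ^ a i : ℂˣ) : ℂ)) *ᵥ v) l = _
    rw [mulVec_diagonal]
  have hs : ∀ l, (HahnSeries.C ((s ^ a l : ℂˣ) : ℂ) : ℂ⸨X⸩) =
      HahnSeries.C ((s ^ a i : ℂˣ) : ℂ) * HahnSeries.C ((s ^ (a l - a i) : ℂˣ) : ℂ) := fun l => by
    rw [← map_mul, ← Units.val_mul, ← _root_.zpow_add, add_sub_cancel]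
  refine ext_of_mulVec fun v l => ?_
  rw [Units.val_mul, ← mulVec_mulVec, hT, elementaryStep_mulVec i hb, Units.val_mul,
    ← mulVec_mulVec, elementaryStep_mulVec i (by simp [hb]), hT, hT, map_mul]
  by_cases hl : l = i
  · subst hl
    rw [hb, map_zero, Pi.single_eq_same]
    ring
  · rw [Pi.single_eq_of_ne hl, hs l]
    ring

/-- The action of the one-parameter subgroup on the coordinates around the fixed point of `w`. -/
noncomputable def scale (a : Fin n → ℤ) (w : List (Fin n)) (s : ℂˣ) (b : ℕ → Fin n → ℂ) (j : ℕ)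
    (l : Fin n) : ℂ :=
  if h : j < w.length then ((s ^ (a l - a w[j]) : ℂˣ) : ℂ) * b j l else 0

/-- The parameters at the positions where they do not matter are `0`. -/
def IsNormalized (w : List (Fin n)) (b : ℕ → Fin n → ℂ) : Prop :=
  ∀ j, ∀ h : j < w.length, b j w[j] = 0

theorem IsNormalized.scale {w : List (Fin n)} {b : ℕ → Fin n → ℂ} (hb : IsNormalized w b)
    (a : Fin n → ℤ) (s : ℂˣ) : IsNormalized w (scale a w s b) := fun j h => by
  rw [KnuthMV.scale, dif_pos h, hb j h, mul_zero]

theorem torus_mul_stepProduct (a : Fin n → ℤ) (ha : ∑ i, a i = 0) (s : ℂˣ) {w : List (Fin n)}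
    {b : ℕ → Fin n → ℂ} (hb : IsNormalized w b) {j : ℕ} (hj : j ≤ w.length) :
    integral n (const n (torus a ha s)) * stepProduct w b j =
      stepProduct w (scale a w s b) j * integral n (const n (torus a ha s)) := by
  induction j with
  | zero => simp [stepProduct]
  | succ j ih =>
    have e : scale a w s b j = fun l => ((s ^ (a l - a w[j]) : ℂˣ) : ℂ) * b j l := by
      funext l; rw [scale, dif_pos (show j < w.length from hj)]
    rw [stepProduct_succ _ hj, stepProduct_succ _ hj, ← mul_assoc, ih (by omega), mul_assoc,
      torus_mul_elementaryStep a ha s (hb j hj), e, mul_assoc]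

end KnuthMV

namespace KnuthMV

open Matrix
open scoped PowerSeries.WithPiTopology

variable {n : ℕ}

/-! ### Neighbourhoods of the torus fixed points -/

theorem continuous_const_shear (i : Fin n) :
    Continuous fun b : Fin n → ℂ => const n (shear i b) := by
  refine continuous_specialLinearGroup_iff.2 fun l m d => ?_
  simp only [const_apply, PowerSeries.coeff_C]
  split_ifs
  · by_cases hm : m = i
    · subst hm
      by_cases hl : l = m
      · subst hl; simp only [shear_apply_diag]; exact continuous_const
      · simp only [shear_apply_self _ _ hl]; exact continuous_apply l
    · simp only [shear_apply_ne _ _ hm]; exact continuous_const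
  · exact continuous_const

theorem continuous_chart (w u : List (Fin n)) : Continuous (chart w u) := by
  refine continuous_pi fun j => ?_
  by_cases h : j < w.length
  · simp only [chart, dif_pos h, map_mul]
    exact (continuous_const.mul ((continuous_const_shear _).comp (continuous_apply j))).mul
      continuous_const
  · simp only [chart, dif_neg h]
    exact continuous_const

theorem constantCoeff_const_mul (k : SL(n, ℂ)) (A : SL(n, ℂ⟦X⟧)) (l m : Fin n) :
    PowerSeries.constantCoeff ((const n k * A).1 l m) =
      (k.1 *ᵥ fun r => PowerSeries.constantCoeff (A.1 r m)) l := by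
  change PowerSeries.constantCoeff (((const n k).1 * A.1) l m) = _
  simp [Matrix.mul_apply, const_apply, Matrix.mulVec, dotProduct]

/-- Every `X` close to `k = weyl i m` has a decomposition
`X t^{-ε_m} = (1 + ∑ b_l E_{l i}) t^{-ε_i} k h` with small `b` and with `h` close to `1`. -/
theorem eventually_exists_decomposition (i m : Fin n) {V : Set SL(n, ℂ⟦X⟧)} (hV : V ∈ 𝓝 1) :
    ∀ᶠ X in 𝓝 (const n (weyl i m)), ∃ b : Fin n → ℂ, (∀ l, ‖b l‖ < 1) ∧ b i = 0 ∧ ∃ h ∈ V,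
      integral n X * tPow (-Pi.single m 1) =
        elementaryStep i b * integral n (const n (weyl i m) * h) := by
  set k := weyl i m with hk
  have hcol : ∀ l, Filter.Tendsto (fun X : SL(n, ℂ⟦X⟧) => PowerSeries.constantCoeff (X.1 l m))
      (𝓝 (const n k)) (𝓝 ((Pi.single i 1 : Fin n → ℂ) l)) := fun l => by
    have h := ((PowerSeries.WithPiTopology.continuous_constantCoeff ℂ).comp
      ((continuous_subtype_val (p := fun A : Matrix (Fin n) (Fin n) ℂ⟦X⟧ => A.det = 1)).matrix_elem
        l m)).tendsto (const n k)
    have e : PowerSeries.constantCoeff ((const n k).1 l m) = (Pi.single i 1 : Fin n → ℂ) l := by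
      rw [const_apply, PowerSeries.constantCoeff_C, weyl_apply]
    rw [← e]
    exact h
  -- Near k the constant term of the entry (i, m) is close to 1, so column m modulo t can be
  -- normalized by dividing by it.
  let β : SL(n, ℂ⟦X⟧) → Fin n → ℂ := fun X l => if l = i then 0 else
    PowerSeries.constantCoeff (X.1 l m) / PowerSeries.constantCoeff (X.1 i m)
  have hβ : Filter.Tendsto β (𝓝 (const n k)) (𝓝 0) := by
    refine tendsto_pi_nhds.2 fun l => ?_
    by_cases hl : l = i
    · simp only [β, if_pos hl]; exact tendsto_const_nhds
    · simp only [β, if_neg hl]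
      have h := (hcol l).div (hcol i) (by simp)
      rw [Pi.single_eq_of_ne hl, zero_div] at h
      exact h
  -- Modulo t, column m of Y is a multiple of e_m, so t^{-ε_m} can be moved past Y by
  -- `exists_integral_conj`.
  let Y : SL(n, ℂ⟦X⟧) → SL(n, ℂ⟦X⟧) := fun X => const n k⁻¹ * (const n (shear i (-β X)) * X)
  have hY : Filter.Tendsto Y (𝓝 (const n k)) (𝓝 1) := by
    have h1 := ((continuous_const_shear i).tendsto (-0)).comp hβ.neg
    have h2 := (h1.mul Filter.tendsto_id).const_mul (const n k⁻¹)
    have e : const n k⁻¹ * (const n (shear i (-0)) * const n k) = 1 := by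
      rw [neg_zero, shear_zero, map_one, one_mul, ← map_mul, inv_mul_cancel, map_one]
    rw [e] at h2
    exact h2
  -- The explicit conjugate by t^{ε_m}, defined for all matrices so that its continuity shows that h
  -- is close to 1.
  let D : SL(n, ℂ⟦X⟧) → Matrix (Fin n) (Fin n) ℂ⟦X⟧ := fun Y => Matrix.of fun l r =>
    if l = m then (if r = m then Y.1 l r else PowerSeries.X * Y.1 l r)
      else if r = m then PowerSeries.mk fun k => PowerSeries.coeff (k + 1) (Y.1 l r) else Y.1 l r
  have hD : Continuous D := by
    have hent : ∀ l r, Continuous fun A : SL(n, ℂ⟦X⟧) => A.1 l r := fun l r =>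
      (continuous_subtype_val (p := fun A : Matrix (Fin n) (Fin n) ℂ⟦X⟧ => A.det = 1)).matrix_elem
        l r
    refine continuous_matrix fun l r => ?_
    simp only [D, Matrix.of_apply]
    split_ifs
    · exact hent l r
    · exact continuous_const.mul (hent l r)
    · refine continuous_iff_continuousAt.2 fun A =>
        (PowerSeries.WithPiTopology.tendsto_iff_coeff_tendsto ℂ _ _ _).2 fun d => ?_
      simp only [PowerSeries.coeff_mk]
      exact ((PowerSeries.WithPiTopology.continuous_coeff ℂ (d + 1)).comp (hent l r)).continuousAt
    · exact hent l r
  have hD1 : D 1 = 1 := by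
    ext l r : 1
    have h1 : ∀ l r, (1 : SL(n, ℂ⟦X⟧)).1 l r = (1 : Matrix (Fin n) (Fin n) ℂ⟦X⟧) l r :=
      fun _ _ => rfl
    simp only [D, Matrix.of_apply, h1]
    by_cases hlr : l = r
    · subst hlr
      by_cases hl : l = m <;> simp [hl]
    · simp only [Matrix.one_apply_ne hlr, mul_zero, map_zero]
      split_ifs <;> rfl
  obtain ⟨V', hV', hVV'⟩ := mem_nhds_induced _ _ _ |>.1 hV
  have hDY : Filter.Tendsto (fun X => D (Y X)) (𝓝 (const n k)) (𝓝 1) := by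
    rw [← hD1]
    exact (hD.tendsto 1).comp hY
  have hne : ∀ᶠ X in 𝓝 (const n k), PowerSeries.constantCoeff (X.1 i m) ≠ 0 :=
    (hcol i).eventually_ne (by simp)
  have hsmall : ∀ᶠ X in 𝓝 (const n k), ∀ l, ‖β X l‖ < 1 := by
    refine Filter.eventually_all.2 fun l => ?_
    have h := (tendsto_pi_nhds.1 hβ l).norm
    rw [Pi.zero_apply, norm_zero] at h
    exact h.eventually_lt_const one_pos
  filter_upwards [hDY hV', hne, hsmall] with X hX1 hX2 hX3
  have hcc : ∀ l, PowerSeries.constantCoeff ((const n (shear i (-β X)) * X).1 l m) =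
      PowerSeries.constantCoeff (X.1 i m) * k.1 l m := fun l => by
    rw [constantCoeff_const_mul, shear_mulVec, weyl_apply]
    by_cases hl : l = i
    · subst hl; simp
    · simp only [Pi.add_apply, Pi.smul_apply, Function.update_of_ne hl, Pi.single_eq_of_ne hl,
        Pi.neg_apply, β, if_neg hl, smul_eq_mul]
      field_simp
      ring
  have hY0 : ∀ l, l ≠ m → PowerSeries.constantCoeff ((Y X).1 l m) = 0 := fun l hl => by
    simp only [Y]
    rw [constantCoeff_const_mul]
    simp only [hcc]
    have e : (k⁻¹.1 *ᵥ fun r => PowerSeries.constantCoeff (X.1 i m) * k.1 r m) l =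
        PowerSeries.constantCoeff (X.1 i m) * (k⁻¹ * k).1 l m := by
      change _ = _ * (k⁻¹.1 * k.1) l m
      simp only [Matrix.mulVec, dotProduct, Matrix.mul_apply, Finset.mul_sum]
      exact Finset.sum_congr rfl fun _ _ => by ring
    rw [e, inv_mul_cancel]
    change _ * (1 : Matrix (Fin n) (Fin n) ℂ) l m = 0
    rw [Matrix.one_apply_ne hl, mul_zero]
  obtain ⟨h, h1, h2⟩ := exists_integral_conj (Y X) m hY0
  refine ⟨β X, hX3, if_pos rfl, h, hVV' ?_, ?_⟩
  · change h.1 ∈ V'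
    rw [h2]
    exact hX1
  · have e : X = const n (shear i (β X)) * const n k * Y X := by
      simp only [Y]
      rw [mul_assoc, ← mul_assoc (const n k), ← map_mul, mul_inv_cancel, map_one, one_mul,
        ← mul_assoc, ← map_mul, shear_mul, add_neg_cancel, shear_zero, map_one, one_mul]
    nth_rewrite 1 [e]
    rw [map_mul, map_mul, mul_assoc, h1, elementaryStep, map_mul, hk]
    simp only [mul_assoc]
    rw [← mul_assoc (tPow _) (integral n (const n _)), tPow_mul_weyl, mul_assoc]

/-- Every tuple close to that of the fixed point of `w` defines a point of the chart around this
fixed point that has small coordinates there. -/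
theorem eventually_exists_frame {w u : List (Fin n)} (hu : u.length = w.length) {J : ℕ}
    (hJ : J ≤ w.length) {V : Set SL(n, ℂ⟦X⟧)} (hV : V ∈ 𝓝 1) :
    ∀ᶠ P in 𝓝 (chart w u 0), ∃ b : ℕ → Fin n → ℂ, (∀ j l, ‖b j l‖ < 1) ∧ IsNormalized w b ∧
      (∀ j ≤ J, ∃ A, frame u P j = stepProduct w b j * integral n A) ∧
      ∃ h ∈ V, frame u P J = stepProduct w b J * integral n (const n (weylAt w u J) * h) := by
  induction J generalizing V with
  | zero =>
    refine Filter.Eventually.of_forall fun P => ⟨0, by simp, fun _ _ => rfl, fun j hj => ⟨1, ?_⟩,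
      1, mem_of_mem_nhds hV, ?_⟩
    · rw [Nat.le_zero.1 hj, frame, stepProduct, map_one, mul_one]
    · simp [frame, stepProduct, weylAt]
  | succ J ih =>
    have hJ' : J < w.length := hJ
    -- The remainder h of the first J steps multiplies the next factor from the left. That product
    -- is still close to the permutation matrix of step J + 1 if h is close to 1, so the induction
    -- hypothesis is used with a smaller neighbourhood V₁.
    have hdec := eventually_exists_decomposition w[J] (u[J]'(hu ▸ hJ')) hV
    rw [← weylAt_succ hJ' (hu ▸ hJ')] at hdec
    have hcont : Filter.Tendsto (fun p : SL(n, ℂ⟦X⟧) × SL(n, ℂ⟦X⟧) =>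
        const n (weylAt w u J) * p.1 * p.2) (𝓝 1 ×ˢ 𝓝 (chart w u 0 J))
        (𝓝 (const n (weylAt w u (J + 1)))) := by
      have h := ((Filter.tendsto_fst (f := 𝓝 (1 : SL(n, ℂ⟦X⟧))) (g := 𝓝 (chart w u 0 J))).const_mul
        (const n (weylAt w u J))).mul Filter.tendsto_snd
      have e : const n (weylAt w u J) * 1 * chart w u 0 J = const n (weylAt w u (J + 1)) := by
        rw [chart, dif_pos hJ', mul_one, Pi.zero_apply, shear_zero, mul_one, ← map_mul,
          mul_inv_cancel_left]
      rwa [e] at h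
    obtain ⟨V₁, hV₁, U, hU, hVU⟩ := Filter.mem_prod_iff.1 (hcont hdec)
    have hPU : ∀ᶠ P in 𝓝 (chart w u 0), P J ∈ U := (continuous_apply J).continuousAt hU
    filter_upwards [ih (by omega) hV₁, hPU] with P ⟨b, hb1, hb2, hb3, h, hh, hfr⟩ hP
    obtain ⟨b', hb1', hb2', h', hh', hdec'⟩ := hVU (Set.mk_mem_prod hh hP)
    have hcongr : ∀ j ≤ J, stepProduct w (Function.update b J b') j = stepProduct w b j :=
      fun j hj => stepProduct_congr fun k hk => Function.update_of_ne (by omega) _ _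
    have hlast : frame u P (J + 1) = stepProduct w (Function.update b J b') (J + 1) *
        integral n (const n (weylAt w u (J + 1)) * h') := by
      rw [frame, hfr, vertex_sub_vertex_succ (hu ▸ hJ'), mul_assoc (stepProduct w b J), ← map_mul,
        mul_assoc, hdec', stepProduct_succ _ hJ', hcongr J le_rfl, Function.update_self, mul_assoc,
        weylAt_succ hJ' (hu ▸ hJ')]
    refine ⟨Function.update b J b', fun j l => ?_, fun j hj => ?_, fun j hj => ?_, h', hh', hlast⟩
    · by_cases hj : j = J
      · subst hj; rw [Function.update_self]; exact hb1' l
      · rw [Function.update_of_ne hj]; exact hb1 j l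
    · by_cases hj : j = J
      · subst hj; rw [Function.update_self]; exact hb2'
      · rw [Function.update_of_ne hj]; exact hb2 j _
    · rcases Nat.le_succ_iff.1 hj with hj | rfl
      · rw [hcongr j hj]; exact hb3 j hj
      · exact ⟨_, hlast⟩

/-! ### The image of a cell -/

/-- The point `x` of the Bott-Samelson variety lies in the chart around the fixed point of `w` and
has the coordinates `b`. -/
def HasCoordinates {u : List (Fin n)} (w : List (Fin n)) (x : BottSamelson u)
    (b : ℕ → Fin n → ℂ) : Prop :=
  ∀ j : Fin (u.length + 1), x.point j = AffineGrassmannian.ofGL (stepProduct w b j)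

theorem BottSamelson.ext_point {u : List (Fin n)} {x y : BottSamelson u}
    (h : ∀ j, x.point j = y.point j) : x = y := by
  obtain ⟨P, rfl⟩ := x.exists_eq_mk
  obtain ⟨P', rfl⟩ := y.exists_eq_mk
  refine BottSamelson.mk_eq_mk_iff.2 fun j hj => (ofGL_eq_ofGL_iff (det_frame u P P' j)).1 ?_
  have := h ⟨j, Nat.lt_succ_of_le hj⟩
  rwa [BottSamelson.point_mk, BottSamelson.point_mk] at this

theorem hasCoordinates_chart {w u : List (Fin n)} (hu : u.length = w.length)
    (b : ℕ → Fin n → ℂ) : HasCoordinates w (BottSamelson.mk u (chart w u b)) b := fun j => by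
  rw [BottSamelson.point_mk, frame_chart hu b (by omega), ofGL_mul_integral]

theorem isFixedPointOf_iff {w u : List (Fin n)} (hu : u.length = w.length) {y : BottSamelson u} :
    IsFixedPointOf w y ↔ y = BottSamelson.mk u (chart w u 0) := by
  have h : ∀ j : Fin (u.length + 1),
      (BottSamelson.mk u (chart w u 0)).point j = coweightPoint (vertex w j) := fun j => by
    rw [hasCoordinates_chart hu 0 j, stepProduct_zero w (by omega)]
    rfl
  exact ⟨fun hy => BottSamelson.ext_point fun j => (hy j).trans (h j).symm, fun hy => hy ▸ h⟩

theorem HasCoordinates.unique {w u : List (Fin n)} (hu : u.length = w.length) {x : BottSamelson u}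
    {b b' : ℕ → Fin n → ℂ} (hb : HasCoordinates w x b) (hb' : HasCoordinates w x b')
    (hn : IsNormalized w b) (hn' : IsNormalized w b') {j : ℕ} (hj : j < w.length) : b' j = b j := by
  funext l
  by_cases hl : l = w[j]
  · rw [hl, hn j hj, hn' j hj]
  · refine stepProduct_unique (fun j hj => ?_) hj hl
    rw [← ofGL_eq_ofGL_iff (det_stepProduct w b b' j)]
    have hj' : j < u.length + 1 := by omega
    exact (hb ⟨j, hj'⟩).symm.trans (hb' ⟨j, hj'⟩)

theorem smul_ofGL_stepProduct (a : Fin n → ℤ) (ha : ∑ i, a i = 0) (s : ℂˣ) (u : List (Fin n))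
    {w : List (Fin n)} {b : ℕ → Fin n → ℂ} (hb : IsNormalized w b) {j : ℕ} (hj : j ≤ w.length) :
    SpecialLinearGroup.toPGL (oneParameter a ha u s).1 •
      AffineGrassmannian.ofGL (stepProduct w b j) =
        AffineGrassmannian.ofGL (stepProduct w (scale a w s b) j) := by
  rw [smul_ofGL, toGL_oneParameter, torus_mul_stepProduct a ha s hb hj, ofGL_mul_integral]

/-- The chart is stable under the torus, which acts on it linearly. -/
theorem hasCoordinates_translate_iff {a : Fin n → ℤ} {ha : ∑ i, a i = 0} {s : ℂˣ}
    {w u : List (Fin n)} (hu : u.length = w.length) {x : BottSamelson u} {b : ℕ → Fin n → ℂ}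
    (hb : IsNormalized w b) :
    HasCoordinates w (BottSamelson.translate (oneParameter a ha u s) x) (scale a w s b) ↔
      HasCoordinates w x b := by
  refine forall_congr' fun j => ?_
  rw [BottSamelson.point_translate, ← smul_ofGL_stepProduct a ha s u hb (by omega),
    smul_left_cancel_iff]

theorem scale_scale_inv (a : Fin n → ℤ) {w : List (Fin n)} (s : ℂˣ) (b : ℕ → Fin n → ℂ) {j : ℕ}
    (hj : j < w.length) : scale a w s (scale a w s⁻¹ b) j = b j := by
  funext l
  rw [scale, dif_pos hj, scale, dif_pos hj, ← mul_assoc, ← Units.val_mul, _root_.inv_zpow,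
    mul_inv_cancel, Units.val_one, one_mul]

theorem eventually_hasCoordinates {w u : List (Fin n)} (hu : u.length = w.length) :
    ∀ᶠ x in 𝓝 (BottSamelson.mk u (chart w u 0)), ∃ b : ℕ → Fin n → ℂ, (∀ j l, ‖b j l‖ < 1) ∧
      IsNormalized w b ∧ HasCoordinates w x b := by
  refine Filter.mem_of_superset (BottSamelson.image_mk_mem_nhds
    (eventually_exists_frame hu le_rfl Filter.univ_mem)) ?_
  rintro _ ⟨P, ⟨b, hb1, hb2, hb3, -⟩, rfl⟩
  refine ⟨b, hb1, hb2, fun j => ?_⟩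
  obtain ⟨A, hA⟩ := hb3 j (by omega)
  rw [BottSamelson.point_mk, hA, ofGL_mul_integral]

/-- Ensures that an event holding for s → 0 in ℂˣ actually occurs for some s. -/
theorem neBot_comap_units_val : (Filter.comap (Units.val : ℂˣ → ℂ) (𝓝 0)).NeBot := by
  refine Filter.comap_neBot fun t ht => ?_
  obtain ⟨z, hz, hz0⟩ := (Filter.nonempty_of_mem
    (Filter.inter_mem (mem_nhdsWithin_of_mem_nhds ht) self_mem_nhdsWithin) :
      (t ∩ ({0}ᶜ : Set ℂ)).Nonempty)
  exact ⟨Units.mk0 z hz0, hz⟩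

theorem eventually_norm_lt {ε : ℝ} (hε : 0 < ε) :
    ∀ᶠ s : ℂˣ in Filter.comap (Units.val : ℂˣ → ℂ) (𝓝 0), ‖(s : ℂ)‖ < ε := by
  have h : ∀ᶠ z : ℂ in 𝓝 0, ‖z‖ < ε :=
    continuous_norm.continuousAt.eventually_lt_const (by simpa using hε)
  exact (Filter.tendsto_comap (f := (Units.val : ℂˣ → ℂ)) (x := 𝓝 0)).eventually h

/-- The points of the cell of `w` are the points of the chart around the fixed point of `w` whose
coordinates are lower triangular. -/
theorem exists_hasCoordinates_of_mem_cell {a : Fin n → ℤ} {ha : ∑ i, a i = 0}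
    (hanti : StrictMono a) {w u : List (Fin n)} (hu : u.length = w.length) {x : BottSamelson u}
    (hx : x ∈ cell a ha u w) : ∃ b : ℕ → Fin n → ℂ,
      (∀ j, ∀ h : j < w.length, ∀ l ≤ w[j], b j l = 0) ∧ HasCoordinates w x b := by
  obtain ⟨y, hy, hlim⟩ := hx
  rw [(isFixedPointOf_iff hu).1 hy] at hlim
  have hev := hlim.eventually (eventually_hasCoordinates hu)
  have := neBot_comap_units_val
  -- Some translate η(s₀)x lies in the chart; as the chart is torus stable, so does x.
  obtain ⟨s₀, b₀, -, hn₀, hb₀⟩ := hev.exists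
  have hn := hn₀.scale a s₀⁻¹
  have hcoord : HasCoordinates w x (scale a w s₀⁻¹ b₀) := by
    rw [← hasCoordinates_translate_iff (ha := ha) (s := s₀) hu hn]
    intro j
    rw [hb₀ j]
    congr 1
    exact stepProduct_congr fun k hk => (scale_scale_inv a s₀ b₀ (by omega)).symm
  refine ⟨_, fun j hj l hl => ?_, hcoord⟩
  rcases hl.eq_or_lt with rfl | hl
  · exact hn j hj
  set b := scale a w s₀⁻¹ b₀
  by_contra hne
  have hpos : 0 < ‖b j l‖ := norm_pos_iff.2 hne
  -- Coordinates of η(s)x are smaller than 1 for small s. By uniqueness this one is s^{a_l - a_i}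
  -- b_l with a_l - a_i ≤ -1, where i = w[j], so its absolute value exceeds 1 once |s| < |b_l| and
  -- |s| < 1.
  obtain ⟨s, ⟨b', hb1', hn', hb'⟩, hs, hs1⟩ := (hev.and ((eventually_norm_lt hpos).and
    (eventually_norm_lt one_pos))).exists
  have e := HasCoordinates.unique hu hb' ((hasCoordinates_translate_iff (ha := ha) hu hn).2 hcoord)
    hn' (hn.scale a s) hj
  have hlt := hb1' j l
  rw [← e, scale, dif_pos hj, norm_mul, Units.val_zpow_eq_zpow_val, norm_zpow] at hlt
  have hs0 : 0 < ‖(s : ℂ)‖ := norm_pos_iff.2 s.ne_zero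
  have hle : ‖(s : ℂ)‖⁻¹ ≤ ‖(s : ℂ)‖ ^ (a l - a w[j]) := by
    rw [← _root_.zpow_neg_one]
    refine zpow_le_zpow_right_of_le_one₀ hs0 hs1.le ?_
    have := hanti hl
    omega
  have h1 : 1 < ‖(s : ℂ)‖⁻¹ * ‖b j l‖ := by
    rw [inv_mul_eq_div, one_lt_div hs0]
    exact hs
  nlinarith [mul_le_mul_of_nonneg_right hle hpos.le]

/-- All nonzero coordinates are scaled by positive powers of s, hence tend to 0, and the
parametrization is continuous. -/
theorem mk_chart_mem_cell {a : Fin n → ℤ} {ha : ∑ i, a i = 0}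
    (hanti : StrictMono a) {w u : List (Fin n)} (hu : u.length = w.length) {b : ℕ → Fin n → ℂ}
    (hb : ∀ j, ∀ h : j < w.length, ∀ l ≤ w[j], b j l = 0) :
    BottSamelson.mk u (chart w u b) ∈ cell a ha u w := by
  have hn : IsNormalized w b := fun j h => hb j h _ le_rfl
  refine ⟨_, (isFixedPointOf_iff hu).2 rfl, ?_⟩
  have e : ∀ s, BottSamelson.translate (oneParameter a ha u s) (BottSamelson.mk u (chart w u b)) =
      BottSamelson.mk u (chart w u (scale a w s b)) := fun s => by
    refine BottSamelson.ext_point fun j => ?_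
    rw [(hasCoordinates_translate_iff hu hn).2 (hasCoordinates_chart hu b) j,
      hasCoordinates_chart hu _ j]
  simp only [e]
  refine (((BottSamelson.continuous_mk u).comp (continuous_chart w u)).tendsto 0).comp ?_
  refine tendsto_pi_nhds.2 fun j => tendsto_pi_nhds.2 fun l => ?_
  by_cases hj : j < w.length
  · simp only [scale, dif_pos hj]
    rcases le_or_gt l w[j] with hl | hl
    · simp only [hb j hj l hl, mul_zero]
      exact tendsto_const_nhds
    · have hd : 0 < a l - a w[j] := sub_pos.2 (hanti hl)
      obtain ⟨d, hd'⟩ := Int.eq_ofNat_of_zero_le hd.le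
      have h0 : d ≠ 0 := by rintro rfl; omega
      simp only [hd', zpow_natCast, Units.val_pow_eq_pow_val]
      have h := ((Filter.tendsto_comap (f := (Units.val : ℂˣ → ℂ)) (x := 𝓝 0)).pow d).mul_const
        (b j l)
      simpa [h0] using h
  -- `scale` is 0 past the end of the word, so convergence holds in the whole product over ℕ.
  · simp only [scale, dif_neg hj]
    exact tendsto_const_nhds

theorem image_cell_eq {a : Fin n → ℤ} {ha : ∑ i, a i = 0} (hanti : StrictMono a)
    {w u : List (Fin n)} (hu : u.length = w.length) :
    BottSamelson.π u '' cell a ha u w = AffineGrassmannian.ofGL '' lowerProducts w := by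
  ext z
  constructor
  · rintro ⟨x, hx, rfl⟩
    obtain ⟨b, hb, hcoord⟩ := exists_hasCoordinates_of_mem_cell hanti hu hx
    refine ⟨_, mem_lowerProducts_iff.2 ⟨b, hb, rfl⟩, ?_⟩
    rw [BottSamelson.π, hcoord, Fin.val_last, hu]
  · rintro ⟨g, hg, rfl⟩
    obtain ⟨b, hb, rfl⟩ := mem_lowerProducts_iff.1 hg
    refine ⟨_, mk_chart_mem_cell hanti hu hb, ?_⟩
    rw [BottSamelson.π, hasCoordinates_chart hu b, Fin.val_last, hu]

theorem KnuthRelation.length_eq {w₁ w₂ : List (Fin n)} (h : KnuthRelation w₁ w₂) :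
    w₁.length = w₂.length := by
  cases h <;> simp

end KnuthMV

/-! ### Cells of Knuth-related words -/

theorem mainTheorem4 (n : ℕ) (a : Fin n → ℤ) (ha : ∑ i, a i = 0) (hanti : StrictMono a)
    (c w₁ w₂ : List (Fin n)) (hc : c.length = w₁.length) (hK : KnuthMV.KnuthRelation w₁ w₂) :
    closure (KnuthMV.BottSamelson.π c '' KnuthMV.cell a ha c w₁) =
      closure (KnuthMV.BottSamelson.π c '' KnuthMV.cell a ha c w₂) := by
  rw [KnuthMV.image_cell_eq hanti hc, KnuthMV.image_cell_eq hanti (hc.trans hK.length_eq),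
    KnuthMV.closure_image_lowerProducts_eq hK]
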